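/- Ostaszewski's principle $\clubsuit$ states: there are sets $S_\gamma\subseteq\gamma$, for countable limit ordinals $\gamma>0$, such that each $S_\gamma$ is cofinal in $\gamma$ with $S_\gamma\cap\beta$ finite for every $\beta<\gamma$, and every uncountable $X\subseteq\omega_1$ includes some $S_\gamma$. Call $(\mathcal S_\gamma)$, indexed by the countable limit ordinals, a *guessing sequence* if each $\mathcal S_\gamma$ is an infinite family of finite sequences in $\gamma\times\omega$ that is *consecutive* (of any two distinct members, one has all first coordinates of its terms strictly below all those of the other) and converges to $\gamma$ (for every $\beta<\gamma$, all but finitely many members have all first coordinates of their terms above $\beta$), and every uncountable consecutive family of finite sequences in $\omega_1\times\omega$ includes some $\mathcal S_\gamma$. Given a guessing sequence, a Dow--Junnila--Pelant space $DJP_1$ is the one-point compactification of a space $L=\bigcup_{\alpha<\omega_1}\{\alpha\}\times\{0,\dots,m_\alpha-1\}$ constructed by recursion on $\alpha$. Write $L_{<\gamma}$ for the set of points of $L$ with first coordinate $<\gamma$. If $\gamma$ is not a limit ordinal, then $m_\gamma=1$ and $(\gamma,0)$ is isolated. If $\gamma$ is a limit ordinal and, for some $m\ge 1$, $\mathcal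 S_\gamma$ consists of $m$-tuples of pairwise distinct points of $L_{<\gamma}$, then $m_\gamma=m$ and one chooses a partition of $L_{<\gamma}$ into open sets $P_{\gamma,0},\dots,P_{\gamma,m-1}$ such that for each $i<m$ the $i$-th terms of all but finitely many members of $\mathcal S_\gamma$ lie in $P_{\gamma,i}$. For all other limit ordinals $\gamma$, $m_\gamma=1$ and $P_{\gamma,0}=L_{<\gamma}$. A set $U\subseteq L$ is open if and only if for each $(\gamma,i)\in U$ with $\gamma$ a limit ordinal there is $\beta<\gamma$ such that $U$ contains all points of $P_{\gamma,i}$ whose first coordinate is $>\beta$. **Statement.** Assume $\clubsuit$. Then guessing sequences exist, for every guessing sequence a space $DJP_1$ as above exists, and every such space $DJP_1$ (for any guessing sequence and any choice of the partitions) is compact Hausdorff, admits a finite-to-one continuous map onto $[0,\omega_1]$ with the order topology, and has the following properties, where $C(K)$ is the Banach space of real-valued continuous functions on $K$ with the supremum norm: 1. for every $n\in\mathbb N$ the space $C(DJP_1^n)$ is weakly pcc, that is, every point-finite family of weakly open subsets of it is countable; 2. for every $n\in\mathbb N$ the space $C(DJP_1^n)$ does not contain a complemented subspace isomorphic to $c_0(\omega_1)$;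 3. $C(DJP_1)$ is not Lindelöf in the weak topology. -/

import Mathlib

open scoped ZeroAtInfty

/-! ### Countable ordinals and Ostaszewski's principle -/

/-- The set `[0, ω₁)` of countable ordinals, with its order (and its order topology). -/
abbrev Omega1 : Type 1 := Set.Iio (Ordinal.omega.{0} 1)

/-- The interval `[0, ω₁]`, with its order topology. -/
abbrev Omega1Closed : Type 1 := Set.Iic (Ordinal.omega.{0} 1)

/-- Ostaszewski's principle ♣: there are sets `S γ ⊆ γ`, for `γ` a countable limit ordinal, such
that `S γ` converges to `γ` (it is cofinal in `γ` and has only finitely many elements below any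
`β < γ`), and every uncountable set of countable ordinals contains some `S γ`. -/
def ClubPrinciple : Prop :=
  ∃ S : Omega1 → Set Omega1,
    (∀ γ, Order.IsSuccLimit γ →
      S γ ⊆ Set.Iio γ ∧ (∀ β < γ, ∃ α ∈ S γ, β < α) ∧ ∀ β < γ, {α ∈ S γ | α ≤ β}.Finite) ∧
    ∀ X : Set Omega1, ¬ X.Countable → ∃ γ, Order.IsSuccLimit γ ∧ S γ ⊆ X

/-- A family of finite sequences in `ω₁ × ω` is consecutive if, of any two distinct members, one
has all its (first coordinates of) terms strictly below all those of the other. -/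
def Consecutive (W : Set (List (Omega1 × ℕ))) : Prop :=
  ∀ s ∈ W, ∀ t ∈ W, s ≠ t →
    (∀ p ∈ s, ∀ q ∈ t, p.1 < q.1) ∨ (∀ p ∈ s, ∀ q ∈ t, q.1 < p.1)

/-- A ♣-sequence for finite sequences in `ω₁ × ω`: for each countable limit ordinal `γ`, an
infinite consecutive family `S γ` of finite sequences in `γ × ω` that converges to `γ` (for each
`β < γ`, all but finitely many members of `S γ` lie above `β`), such that every uncountable
consecutive family of finite sequences in `ω₁ × ω` includes some `S γ`. -/
structure IsGuessing (S : Omega1 → Set (List (Omega1 × ℕ))) : Prop where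
  lt : ∀ γ, Order.IsSuccLimit γ → ∀ s ∈ S γ, ∀ p ∈ s, p.1 < γ
  infinite : ∀ γ, Order.IsSuccLimit γ → (S γ).Infinite
  consecutive : ∀ γ, Order.IsSuccLimit γ → Consecutive (S γ)
  converges : ∀ γ, Order.IsSuccLimit γ → ∀ β < γ, {s ∈ S γ | ∃ p ∈ s, p.1 ≤ β}.Finite
  guesses : ∀ W : Set (List (Omega1 × ℕ)), ¬ W.Countable → Consecutive W →
    ∃ γ, Order.IsSuccLimit γ ∧ S γ ⊆ W

/-! ### The Dow–Junnila–Pelant space -/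

/-- The set `⋃_{α < ω₁} {α} × {0, …, mult α - 1}`: the ordinal `α` is split into `mult α`
points. -/
def SplitPoint (mult : Omega1 → ℕ) : Type 1 := {p : Omega1 × ℕ // p.2 < mult p.1}

/-- The topology on the split ordinals in which `(γ, i)` is isolated when `γ` is not a limit, and
in which, for `γ` a limit, a set is a neighbourhood of `(γ, i)` as soon as it is a neighbourhood of
its other points and contains a tail `{r ∈ P γ i : β < r}` of the piece `P γ i`. -/
abbrev splitTopology (mult : Omega1 → ℕ) (P : Omega1 → ℕ → Set (SplitPoint mult)) :
    TopologicalSpace (SplitPoint mult) where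
  IsOpen U := ∀ q ∈ U, Order.IsSuccLimit q.1.1 →
    ∃ β < q.1.1, ∀ r ∈ P q.1.1 q.1.2, β < r.1.1 → r ∈ U
  isOpen_univ := by
    intro q _ hq
    obtain ⟨β, hβ⟩ := not_isMin_iff.1 hq.1
    exact ⟨β, hβ, fun r _ _ => Set.mem_univ r⟩
  isOpen_inter := by
    intro U V hU hV q hq hlim
    obtain ⟨β₁, h₁, hU'⟩ := hU q hq.1 hlim
    obtain ⟨β₂, h₂, hV'⟩ := hV q hq.2 hlim
    exact ⟨max β₁ β₂, max_lt h₁ h₂, fun r hr hlt =>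
      ⟨hU' r hr (lt_of_le_of_lt (le_max_left _ _) hlt),
        hV' r hr (lt_of_le_of_lt (le_max_right _ _) hlt)⟩⟩
  isOpen_sUnion := by
    intro 𝒰 h𝒰 q hq hlim
    obtain ⟨U, hU, hqU⟩ := hq
    obtain ⟨β, hβ, h⟩ := h𝒰 U hU q hqU hlim
    exact ⟨β, hβ, fun r hr hlt => ⟨U, hU, h r hr hlt⟩⟩

/-- The family `S γ` consists of `m`-tuples (`m ≥ 1`) of distinct points of the space. -/
def IsTupleGuess (S : Omega1 → Set (List (Omega1 × ℕ))) (mult : Omega1 → ℕ) (γ : Omega1) (m : ℕ) :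
    Prop :=
  0 < m ∧ ∀ s ∈ S γ, s.length = m ∧ s.Nodup ∧ ∀ p ∈ s, p.2 < mult p.1

/-- A run of the Dow–Junnila–Pelant construction along `S`.  At a limit stage `γ` at which `S γ`
consists of `m`-tuples of distinct points of the space `X_{<γ}` built so far, `X_{<γ}` is
partitioned into `m` open pieces `P γ 0, …, P γ (m - 1)`, such that the `i`-th terms of all but
finitely many members of `S γ` lie in `P γ i`, and `m` new points `(γ, 0), …, (γ, m - 1)` are
added, where the neighbourhoods of `(γ, i)` come from the tails of `P γ i`.  At any other limit
stage, one point is added, with the tails of `X_{<γ}`.  At a stage that is not a limit one isolated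
point is added. -/
structure DJPConstruction (S : Omega1 → Set (List (Omega1 × ℕ))) where
  /-- the number of points added at each stage -/
  mult : Omega1 → ℕ
  /-- the pieces chosen at each limit stage -/
  piece : Omega1 → ℕ → Set (SplitPoint mult)
  mult_of_not_limit : ∀ γ, ¬ Order.IsSuccLimit γ → mult γ = 1
  mult_of_guess : ∀ γ, Order.IsSuccLimit γ → ∀ m, IsTupleGuess S mult γ m → mult γ = m
  mult_of_no_guess : ∀ γ, Order.IsSuccLimit γ → (¬ ∃ m, IsTupleGuess S mult γ m) → mult γ = 1
  piece_isOpen : ∀ γ, Order.IsSuccLimit γ → ∀ i < mult γ,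
    @IsOpen _ (splitTopology mult piece) (piece γ i)
  piece_disjoint : ∀ γ, Order.IsSuccLimit γ → ∀ i < mult γ, ∀ j < mult γ, i ≠ j →
    Disjoint (piece γ i) (piece γ j)
  piece_cover : ∀ γ, Order.IsSuccLimit γ →
    ⋃ i ∈ Set.Iio (mult γ), piece γ i = {q : SplitPoint mult | q.1.1 < γ}
  piece_guess : ∀ γ, Order.IsSuccLimit γ → ∀ m, IsTupleGuess S mult γ m → ∀ i < m,
    {s ∈ S γ | ¬ ∃ q ∈ piece γ i, s[i]? = some q.1}.Finite

/-- The locally compact space `⋃_{α < ω₁} {α} × {0, …, mult α - 1}` that is constructed. -/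
def DJPConstruction.Points {S : Omega1 → Set (List (Omega1 × ℕ))} (D : DJPConstruction S) :
    Type 1 := SplitPoint D.mult

instance {S : Omega1 → Set (List (Omega1 × ℕ))} (D : DJPConstruction S) :
    TopologicalSpace D.Points := splitTopology D.mult D.piece

/-- The Dow–Junnila–Pelant space: the one-point compactification. -/
abbrev DJPConstruction.Space {S : Omega1 → Set (List (Omega1 × ℕ))} (D : DJPConstruction S) :
    Type 1 := OnePoint D.Points

/-! ### Properties of Banach spaces -/

/-- Weakly pcc: every point-finite family of weakly open sets is countable. -/
def WeaklyPcc (X : Type*) [NormedAddCommGroup X] [NormedSpace ℝ X] : Prop :=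
  ∀ 𝒰 : Set (Set (WeakSpace ℝ X)), (∀ U ∈ 𝒰, IsOpen U) →
    (∀ x : WeakSpace ℝ X, {U ∈ 𝒰 | x ∈ U}.Finite) → 𝒰.Countable

/-- The set `ω₁` with the discrete topology. -/
def DiscreteOmega1 : Type 1 := Omega1

instance : TopologicalSpace DiscreteOmega1 := ⊥

instance : DiscreteTopology DiscreteOmega1 := ⟨rfl⟩

/-- `X` contains a complemented copy of `c₀(ω₁)`: some (closed) subspace which is the range of a
bounded linear projection is linearly homeomorphic to `c₀(ω₁)`. -/
def ContainsComplementedC0Omega1 (X : Type*) [NormedAddCommGroup X] [NormedSpace ℝ X] : Prop :=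
  ∃ Y : Submodule ℝ X, Y.ClosedComplemented ∧ Nonempty (Y ≃L[ℝ] C₀(DiscreteOmega1, ℝ))

open Topology

/-! ### Countable ordinals -/

namespace Omega1

/-! The core is that the powers are weakly pcc. Given uncountably many nonempty weakly open sets `u
α`, choose `f α ∈ u α`. The finite-to-one map to a power of `[0, ω₁]` makes the space scattered, so
on bounded sets weakly open sets are pointwise open (`exists_finite_of_isOpen_weakSpace`):
membership in `u α` is secured by approximating `f α` on a finite set. Passing to uncountably many
`α` makes the norm bounds, the errors and the rounded values agree, and makes the points involved
consist of a common root and consecutive tuples above it (`exists_consecutive_root`). Some `S γ`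
consists of such tuples, and their `i`-th terms converge to `(γ, i)`. Because `γ` was split, these
limits are distinct from each other, from the root and from infinity, so a locally constant map
tells them apart. Folding the space along this map onto one fixed tuple turns a single `f α₀` into a
continuous function that lies in `u α` for infinitely many `α`; the family is not point-finite.

A complemented copy of `c₀(ω₁)` would carry an uncountable point-finite family defined by its
coordinates, so weak pcc excludes it. The weak Lindelöf property fails because infinity is not in
the closure of any countable set of other points.

Guessing sequences come from ♣ by coding finite sequences as countable ordinals. The pieces exist
because consecutive convergent tuples cut the space below `γ` into clopen blocks, in each of which
the terms of one tuple can be separated (`IsSplitting.exists_partition`). -/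

theorem countable_Iio (γ : Omega1) : (Set.Iio γ).Countable := by
  have h : (Set.Iio γ.1).Countable := by
    rw [← Cardinal.le_aleph0_iff_set_countable, Cardinal.mk_Iio_ordinal, Cardinal.lift_le_aleph0]
    have h2 := Cardinal.lt_ord.1 ((Cardinal.ord_aleph 1).symm ▸ γ.2 : γ.1 < (Cardinal.aleph 1).ord)
    rwa [← Cardinal.succ_aleph0, Order.lt_succ_iff] at h2
  exact (h.preimage Subtype.val_injective).mono fun α hα => hα

theorem countable_Iic (γ : Omega1) : (Set.Iic γ).Countable := by
  rw [← Set.Iio_insert]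
  exact (countable_Iio γ).insert γ

theorem mk_eq : Cardinal.mk Omega1 = Cardinal.aleph 1 := by
  rw [Cardinal.mk_Iio_ordinal, Ordinal.card_omega]
  simp

instance : Uncountable Omega1 := by
  rw [← Cardinal.aleph0_lt_mk_iff, mk_eq]
  exact Cardinal.aleph0_lt_aleph_one

theorem exists_gt_of_countable {C : Set Omega1} (hC : C.Countable) : ∃ β, ∀ α ∈ C, α < β := by
  by_contra! h
  refine Set.not_countable_univ (α := Omega1) ((hC.biUnion fun α _ => countable_Iic α).mono ?_)
  intro β _
  obtain ⟨α, hα, hβ⟩ := h β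
  exact Set.mem_biUnion hα hβ

instance : NoMaxOrder Omega1 :=
  ⟨fun α => (exists_gt_of_countable (Set.countable_singleton α)).imp fun _ h => h α rfl⟩

instance : Nonempty Omega1 := Infinite.nonempty _

/-- Definition by recursion along `ω₁`, where the part of the function that is not yet defined is
replaced by a default. -/
theorem exists_recursive {V : Type*} (d : Omega1 → V) (F : Omega1 → (Omega1 → V) → V) :
    ∃ g : Omega1 → V, ∀ γ, g γ = F γ fun δ => if δ < γ then g δ else d δ := by
  classical
  refine ⟨(wellFounded_lt (α := Omega1)).fix fun γ h =>
    F γ fun δ => if hδ : δ < γ then h δ hδ else d δ, fun γ => ?_⟩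
  rw [WellFounded.fix_eq]
  congr 1

end Omega1

/-! ### Uncountable sets -/

/-- If every countable set has an upper bound outside of it with respect to a relation, then
there is an uncountable chain. -/
theorem exists_uncountable_isChain {A : Type*} (r : A → A → Prop)
    (h : ∀ C : Set A, C.Countable → ∃ y ∉ C, ∀ c ∈ C, r c y) :
    ∃ Y : Set A, ¬ Y.Countable ∧ IsChain r Y := by
  -- A countable maximal chain could be extended by its outside upper bound.
  refine ⟨maxChain r, fun hc => ?_, maxChain_spec.1⟩
  obtain ⟨y, hy, hr⟩ := h _ hc
  have h1 : IsChain r (insert y (maxChain r)) :=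
    maxChain_spec.1.insert fun b hb _ => Or.inr (hr b hb)
  exact hy (maxChain_spec.2 h1 (Set.subset_insert _ _) ▸ Set.mem_insert _ _)

theorem Set.exists_uncountable_fiber {A B : Type*} [Countable B] {s : Set A} (hs : ¬ s.Countable)
    (f : A → B) : ∃ b, ¬ {a ∈ s | f a = b}.Countable := by
  by_contra! h
  refine hs ((Set.countable_iUnion h).mono fun a ha => ?_)
  exact Set.mem_iUnion.2 ⟨f a, ha, rfl⟩

/-- Among uncountably many finite sets of bounded size, uncountably many have a common part `R` such
that only countably many of them contain any given further point. -/
theorem exists_maximal_root {A B : Type*} {s : Set A} (hs : ¬ s.Countable) (H : A → Finset B)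
    (N : ℕ) (hN : ∀ a ∈ s, (H a).card ≤ N) :
    ∃ R : Finset B, ¬ {a ∈ s | R ⊆ H a}.Countable ∧
      ∀ x ∉ R, {a ∈ s | R ⊆ H a ∧ x ∈ H a}.Countable := by
  classical
  -- The root is a set of largest cardinality contained in uncountably many `H a`; a further point
  -- in uncountably many of these would give a larger one.
  let Q : ℕ → Prop := fun k => ∃ R : Finset B, R.card = k ∧ ¬ {a ∈ s | R ⊆ H a}.Countable
  have h0 : Q 0 := ⟨∅, rfl, by simpa using hs⟩
  have hQ : ∀ k, Q k → k ≤ N := by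
    rintro k ⟨R, rfl, hR⟩
    obtain ⟨a, ha, hRa⟩ : {a ∈ s | R ⊆ H a}.Nonempty := by
      rw [Set.nonempty_iff_ne_empty]
      intro h
      exact hR (h ▸ Set.countable_empty)
    exact (Finset.card_le_card hRa).trans (hN a ha)
  obtain ⟨R, hRk, hR⟩ := Nat.findGreatest_spec (P := Q) (Nat.zero_le N) h0
  refine ⟨R, hR, fun x hx => ?_⟩
  by_contra h
  have h1 : Q (insert x R).card := by
    refine ⟨_, rfl, ?_⟩
    convert h using 4
    rw [Finset.insert_subset_iff, and_comm (a := x ∈ _)]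
  have h2 := Nat.le_findGreatest (hQ _ h1) h1
  rw [Finset.card_insert_of_notMem hx] at h2
  omega

/-! ### Existence of guessing sequences -/

/-- The conditions on a guessing sequence at one limit ordinal. -/
structure IsConvergent (γ : Omega1) (T : Set (List (Omega1 × ℕ))) : Prop where
  lt : ∀ s ∈ T, ∀ p ∈ s, p.1 < γ
  infinite : T.Infinite
  consecutive : Consecutive T
  converges : ∀ β < γ, {s ∈ T | ∃ p ∈ s, p.1 ≤ β}.Finite

theorem infinite_of_cofinal {γ : Omega1} (hγ : Order.IsSuccLimit γ) {T : Set Omega1}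
    (hT : T ⊆ Set.Iio γ) (hc : ∀ β < γ, ∃ α ∈ T, β < α) : T.Infinite := by
  intro hfin
  obtain ⟨β, hβ⟩ := not_isMin_iff.1 hγ.1
  obtain ⟨α, hα, -⟩ := hc β hβ
  obtain ⟨μ, hμ⟩ := hfin.exists_maximal ⟨α, hα⟩
  obtain ⟨ν, hν, hlt⟩ := hc μ (hT hμ.1)
  exact hlt.not_ge (hμ.2 hν hlt.le)

/-- This is the fallback at those `γ` where the set guessed by ♣ does not code a convergent family.
-/
theorem isConvergent_singletons {γ : Omega1} (hγ : Order.IsSuccLimit γ) {T : Set Omega1}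
    (hT : T ⊆ Set.Iio γ) (hc : ∀ β < γ, ∃ α ∈ T, β < α)
    (hf : ∀ β < γ, {α ∈ T | α ≤ β}.Finite) :
    IsConvergent γ ((fun α => [(α, 0)]) '' T) where
  lt := by
    rintro _ ⟨α, hα, rfl⟩ p hp
    obtain rfl := List.mem_singleton.1 hp
    exact hT hα
  infinite := by
    refine (infinite_of_cofinal hγ hT hc).image ?_
    intro a _ b _ h
    simpa using h
  consecutive := by
    rintro _ ⟨α, hα, rfl⟩ _ ⟨β, hβ, rfl⟩ hne
    rcases lt_trichotomy α β with h | h | h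
    · left; simpa using h
    · exact absurd (h ▸ rfl) hne
    · right; simpa using h
  converges := by
    intro β hβ
    refine ((hf β hβ).image fun α => [(α, 0)]).subset ?_
    rintro _ ⟨⟨α, hα, rfl⟩, p, hp, hle⟩
    obtain rfl := List.mem_singleton.1 hp
    exact ⟨α, ⟨hα, hle⟩, rfl⟩

/-- This coding lets ♣, which speaks of sets of ordinals, guess families of finite sequences. -/
theorem nonempty_equiv_list : Nonempty (Omega1 ≃ List (Omega1 × ℕ)) := by
  rw [← Cardinal.eq, Cardinal.mk_list_eq_mk, Cardinal.mk_prod, Omega1.mk_eq]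
  simp [Cardinal.aleph0_le_aleph]

theorem Consecutive.mono {W W' : Set (List (Omega1 × ℕ))} (h : Consecutive W) (hW : W' ⊆ W) :
    Consecutive W' := fun s hs t ht => h s (hW hs) t (hW ht)

theorem Consecutive.eq_of_mem {W : Set (List (Omega1 × ℕ))} (h : Consecutive W)
    {s t : List (Omega1 × ℕ)} (hs : s ∈ W) (ht : t ∈ W) {p q : Omega1 × ℕ} (hp : p ∈ s)
    (hq : q ∈ t) (hpq : p.1 = q.1) : s = t := by
  by_contra hne
  rcases h s hs t ht hne with h | h
  · exact (h p hp q hq).ne hpq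
  · exact (h p hp q hq).ne' hpq

/-- An uncountable consecutive family of nonempty sequences has members above any bound. -/
theorem Consecutive.countable_not_above {W : Set (List (Omega1 × ℕ))} (h : Consecutive W)
    (β : Omega1) : {s ∈ W | ∃ p ∈ s, p.1 ≤ β}.Countable := by
  classical
  -- By consecutiveness each ordinal occurs in at most one member.
  have h1 : ∀ α ∈ Set.Iic β, {s ∈ W | ∃ p ∈ s, p.1 = α}.Countable := fun α _ => by
    refine Set.Subsingleton.countable ?_
    rintro s ⟨hs, p, hp, rfl⟩ t ⟨ht, q, hq, hqp⟩
    exact h.eq_of_mem hs ht hp hq hqp.symm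
  refine ((Omega1.countable_Iic β).biUnion h1).mono ?_
  rintro s ⟨hs, p, hp, hle⟩
  exact Set.mem_biUnion hle ⟨hs, p, hp, rfl⟩

theorem ClubPrinciple.exists_isGuessing (hclub : ClubPrinciple) :
    ∃ S : Omega1 → Set (List (Omega1 × ℕ)), IsGuessing S := by
  classical
  obtain ⟨T, hT, hguess⟩ := hclub
  obtain ⟨e⟩ := nonempty_equiv_list
  let S : Omega1 → Set (List (Omega1 × ℕ)) := fun γ =>
    if IsConvergent γ (e '' T γ) then e '' T γ else (fun α => [(α, 0)]) '' T γ
  have hS : ∀ γ, Order.IsSuccLimit γ → IsConvergent γ (S γ) := by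
    intro γ hγ
    by_cases h : IsConvergent γ (e '' T γ)
    · simpa only [S, if_pos h] using h
    · simp only [S, if_neg h]
      exact isConvergent_singletons hγ (hT γ hγ).1 (hT γ hγ).2.1 (hT γ hγ).2.2
  refine ⟨S, fun γ hγ => (hS γ hγ).lt, fun γ hγ => (hS γ hγ).infinite,
    fun γ hγ => (hS γ hγ).consecutive, fun γ hγ => (hS γ hγ).converges, fun W hW hcons => ?_⟩
  let X : Set Omega1 := {x | e x ∈ W ∧ e x ≠ []}
  have hX : ¬ X.Countable := by
    intro h
    refine hW (((h.image e).insert []).mono fun s hs => ?_)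
    by_cases hnil : s = []
    · exact Or.inl hnil
    · exact Or.inr ⟨e.symm s, ⟨by simpa using hs, by simpa using hnil⟩, by simp⟩
  -- Along a chain for `r` the codes and the coded sequences interleave, so cofinality and
  -- convergence of a set of codes pass to the sequences.
  let r : X → X → Prop := fun x y =>
    x.1 < y.1 ∧ (∀ p ∈ e y.1, x.1 < p.1) ∧ ∀ p ∈ e x.1, p.1 < y.1
  obtain ⟨Y, hY, hchain⟩ := exists_uncountable_isChain r (by
    intro C hC
    obtain ⟨β, hβ⟩ := Omega1.exists_gt_of_countable
      (C := ⋃ x ∈ C, insert x.1 {α | ∃ p ∈ e x.1, p.1 = α})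
      (hC.biUnion fun x _ => (((e x.1).toFinset.finite_toSet.image Prod.fst).subset (by
        rintro _ ⟨p, hp, rfl⟩; exact ⟨p, by simpa using hp, rfl⟩)).countable.insert _)
    have hbad : (Set.Iic β ∪ e ⁻¹' {s ∈ W | ∃ p ∈ s, p.1 ≤ β}).Countable :=
      (Omega1.countable_Iic β).union ((hcons.countable_not_above β).preimage e.injective)
    obtain ⟨y, hyX, hy⟩ : (X \ (Set.Iic β ∪ e ⁻¹' {s ∈ W | ∃ p ∈ s, p.1 ≤ β})).Nonempty := by
      rw [Set.sdiff_nonempty]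
      exact fun h => hX (hbad.mono h)
    have hyβ : β < y := not_le.1 fun h => hy (Or.inl h)
    have hr : ∀ c ∈ C, r c ⟨y, hyX⟩ := by
      intro c hc
      have h1 : c.1 < β := hβ _ (Set.mem_biUnion hc (Set.mem_insert _ _))
      refine ⟨h1.trans hyβ, fun p hp => h1.trans (not_le.1 fun h => ?_), fun p hp => ?_⟩
      · exact hy (Or.inr ⟨hyX.1, p, hp, h⟩)
      · exact (hβ _ (Set.mem_biUnion hc (Set.mem_insert_of_mem _ ⟨p, hp, rfl⟩))).trans hyβ
    exact ⟨⟨y, hyX⟩, fun h => (hr _ h).1.false, hr⟩)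
  obtain ⟨γ, hγ, hsub⟩ := hguess (Subtype.val '' Y) fun h =>
    hY (Set.countable_of_injective_of_countable_image Subtype.val_injective.injOn h)
  have hlt : ∀ x ∈ T γ, ∀ y ∈ T γ, x < y → (∀ p ∈ e y, x < p.1) ∧ ∀ p ∈ e x, p.1 < y := by
    intro x hx y hy hxy
    obtain ⟨x', hx', rfl⟩ := hsub hx
    obtain ⟨y', hy', rfl⟩ := hsub hy
    rcases hchain hx' hy' (fun h => hxy.ne (congrArg _ h)) with h | h
    · exact h.2
    · exact absurd h.1 hxy.not_gt
  have hTW : e '' T γ ⊆ W := by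
    rintro _ ⟨x, hx, rfl⟩
    obtain ⟨x', -, rfl⟩ := hsub hx
    exact x'.2.1
  obtain ⟨hTγ, hcof, hfin⟩ := hT γ hγ
  have hconv : IsConvergent γ (e '' T γ) := by
    refine ⟨?_, (infinite_of_cofinal hγ hTγ hcof).image e.injective.injOn, hcons.mono hTW, ?_⟩
    · rintro _ ⟨x, hx, rfl⟩ p hp
      obtain ⟨y, hy, hxy⟩ := hcof x (hTγ hx)
      exact ((hlt x hx y hy hxy).2 p hp).trans (hTγ hy)
    · intro β hβ
      obtain ⟨x, hx, hβx⟩ := hcof β hβ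
      refine ((hfin x (hTγ hx)).image e).subset ?_
      rintro _ ⟨⟨y, hy, rfl⟩, p, hp, hle⟩
      refine ⟨y, ⟨hy, not_lt.1 fun hxy => ?_⟩, rfl⟩
      exact (hβx.trans ((hlt x hx y hy hxy).1 p hp)).not_ge hle
  exact ⟨γ, hγ, by simpa only [S, if_pos hconv] using hTW⟩

/-! ### The topology of split ordinals -/

/-- At each limit ordinal the pieces form a partition into open sets. -/
structure IsSplitting (mult : Omega1 → ℕ) (P : Omega1 → ℕ → Set (SplitPoint mult)) : Prop where
  pos : ∀ γ, 0 < mult γ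
  isOpen : ∀ γ, Order.IsSuccLimit γ → ∀ i < mult γ, IsOpen[splitTopology mult P] (P γ i)
  disjoint : ∀ γ, Order.IsSuccLimit γ → ∀ i < mult γ, ∀ j < mult γ, i ≠ j →
    Disjoint (P γ i) (P γ j)
  cover : ∀ γ, Order.IsSuccLimit γ →
    ⋃ i ∈ Set.Iio (mult γ), P γ i = {q : SplitPoint mult | q.1.1 < γ}

namespace IsSplitting

variable {mult : Omega1 → ℕ} {P : Omega1 → ℕ → Set (SplitPoint mult)}

theorem finite_fiber (mult : Omega1 → ℕ) (γ : Omega1) :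
    {q : SplitPoint mult | q.1.1 = γ}.Finite := by
  refine Set.Finite.of_finite_image (f := fun q => q.1.2)
    ((Set.finite_Iio (mult γ)).subset ?_) ?_
  · rintro _ ⟨q, hq, rfl⟩
    have h := q.2
    rw [show q.1.1 = γ from hq] at h
    exact h
  · rintro q hq r hr h
    exact Subtype.ext (Prod.ext (hq.trans (Eq.symm hr)) h)

theorem lt_of_mem (h : IsSplitting mult P) {γ : Omega1} (hγ : Order.IsSuccLimit γ) {i : ℕ}
    (hi : i < mult γ) {q : SplitPoint mult} (hq : q ∈ P γ i) : q.1.1 < γ := by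
  have : q ∈ {q : SplitPoint mult | q.1.1 < γ} := by
    rw [← h.cover γ hγ]
    exact Set.mem_biUnion (show i ∈ Set.Iio (mult γ) from hi) hq
  exact this

theorem exists_mem (h : IsSplitting mult P) {γ : Omega1} (hγ : Order.IsSuccLimit γ)
    {q : SplitPoint mult} (hq : q.1.1 < γ) : ∃ i < mult γ, q ∈ P γ i := by
  have : q ∈ ⋃ i ∈ Set.Iio (mult γ), P γ i := by
    rw [h.cover γ hγ]
    exact hq
  simpa using this

theorem isOpen_Iic (h : IsSplitting mult P) (β : Omega1) :
    IsOpen[splitTopology mult P] {q : SplitPoint mult | q.1.1 ≤ β} := by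
  intro q hq hlim
  obtain ⟨δ, hδ⟩ := not_isMin_iff.1 hlim.1
  exact ⟨δ, hδ, fun r hr _ => (h.lt_of_mem hlim q.2 hr).le.trans hq⟩

theorem isOpen_Iio (h : IsSplitting mult P) (β : Omega1) :
    IsOpen[splitTopology mult P] {q : SplitPoint mult | q.1.1 < β} := by
  intro q hq hlim
  obtain ⟨δ, hδ⟩ := not_isMin_iff.1 hlim.1
  exact ⟨δ, hδ, fun r hr _ => (h.lt_of_mem hlim q.2 hr).trans hq⟩

theorem isOpen_Ioi (mult : Omega1 → ℕ) (P : Omega1 → ℕ → Set (SplitPoint mult)) (β : Omega1) :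
    IsOpen[splitTopology mult P] {q : SplitPoint mult | β < q.1.1} :=
  fun _ hq _ => ⟨β, hq, fun _ _ hr => hr⟩

theorem isClopen_Iic (h : IsSplitting mult P) (β : Omega1) :
    @IsClopen _ (splitTopology mult P) {q : SplitPoint mult | q.1.1 ≤ β} := by
  let _ := splitTopology mult P
  refine ⟨⟨?_⟩, h.isOpen_Iic β⟩
  convert isOpen_Ioi mult P β using 1
  ext q
  simp

/-- A point together with its piece is a neighbourhood of the point. -/
theorem isOpen_insert (h : IsSplitting mult P) (q : SplitPoint mult)
    (hq : Order.IsSuccLimit q.1.1) :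
    IsOpen[splitTopology mult P] (insert q (P q.1.1 q.1.2)) := by
  intro r hr hlim
  rcases hr with rfl | hr
  · obtain ⟨δ, hδ⟩ := not_isMin_iff.1 hlim.1
    exact ⟨δ, hδ, fun s hs _ => Or.inr hs⟩
  · obtain ⟨δ, hδ, hsub⟩ := h.isOpen _ hq _ q.2 r hr hlim
    exact ⟨δ, hδ, fun s hs hδs => Or.inr (hsub s hs hδs)⟩

theorem isOpen_singleton (mult : Omega1 → ℕ) (P : Omega1 → ℕ → Set (SplitPoint mult))
    (q : SplitPoint mult) (hq : ¬ Order.IsSuccLimit q.1.1) :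
    IsOpen[splitTopology mult P] {q} := by
  rintro r rfl hlim
  exact absurd hlim hq

/-- A point outside is separated from this set by another piece at the same limit, by its own basic
neighbourhood if it has the same height, or by the open set of all higher points. -/
theorem isClopen_insert (h : IsSplitting mult P) (q : SplitPoint mult)
    (hq : Order.IsSuccLimit q.1.1) :
    @IsClopen _ (splitTopology mult P) (insert q (P q.1.1 q.1.2)) := by
  let _ := splitTopology mult P
  refine ⟨⟨isOpen_iff_forall_mem_open.2 fun r hr => ?_⟩, h.isOpen_insert q hq⟩
  have hrq : r ≠ q := fun h => hr (Or.inl h)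
  have hrP : r ∉ P q.1.1 q.1.2 := fun h => hr (Or.inr h)
  rcases lt_trichotomy r.1.1 q.1.1 with hlt | heq | hgt
  · obtain ⟨i, hi, hri⟩ := h.exists_mem hq hlt
    have hne : i ≠ q.1.2 := by rintro rfl; exact hrP hri
    refine ⟨P q.1.1 i, fun s hs hs' => ?_, h.isOpen _ hq _ hi, hri⟩
    rcases hs' with rfl | hs'
    · exact (h.lt_of_mem hq hi hs).false
    · exact Set.disjoint_left.1 (h.disjoint _ hq _ hi _ q.2 hne) hs hs'
  · have hne : r.1.2 ≠ q.1.2 := fun h => hrq (Subtype.ext (Prod.ext heq h))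
    refine ⟨_, fun s hs hs' => ?_, h.isOpen_insert r (heq ▸ hq), Set.mem_insert _ _⟩
    have hri : r.1.2 < mult q.1.1 := heq ▸ r.2
    rw [heq] at hs
    rcases hs with rfl | hs <;> rcases hs' with rfl | hs'
    · exact hrq rfl
    · exact hrP hs'
    · exact (h.lt_of_mem hq hri hs).false
    · exact Set.disjoint_left.1 (h.disjoint _ hq _ hri _ q.2 hne) hs hs'
  · refine ⟨_, fun s hs hs' => ?_, isOpen_Ioi mult P q.1.1, hgt⟩
    rcases hs' with rfl | hs'
    · exact lt_irrefl s.1.1 hs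
    · exact (h.lt_of_mem hq q.2 hs').not_gt hs

theorem totallySeparatedSpace (h : IsSplitting mult P) :
    @TotallySeparatedSpace _ (splitTopology mult P) := by
  let _ := splitTopology mult P
  rw [totallySeparatedSpace_iff_exists_isClopen]
  intro q r hqr
  rcases lt_trichotomy q.1.1 r.1.1 with hlt | heq | hgt
  · exact ⟨_, h.isClopen_Iic q.1.1, le_refl q.1.1, not_le.2 hlt⟩
  · by_cases hq : Order.IsSuccLimit q.1.1
    · refine ⟨_, h.isClopen_insert q hq, Set.mem_insert _ _, ?_⟩
      rintro (rfl | hr)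
      · exact hqr rfl
      · exact (h.lt_of_mem hq q.2 hr).ne' heq
    · refine ⟨{q}, ⟨⟨?_⟩, isOpen_singleton mult P q hq⟩, rfl, fun h => hqr h.symm⟩
      -- `IsSplitting` allows several points at a non-limit height, so the others at this height
      -- must be covered too; they are isolated as well.
      have h1 : ({q} : Set (SplitPoint mult))ᶜ =
          ({s | s.1.1 < q.1.1} ∪ {s | q.1.1 < s.1.1}) ∪
            ⋃ s ∈ {s : SplitPoint mult | s.1.1 = q.1.1 ∧ s ≠ q}, {s} := by
        ext s
        rw [Set.biUnion_of_singleton]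
        simp only [Set.mem_compl_iff, Set.mem_singleton_iff, Set.mem_union, Set.mem_ofPred_eq]
        constructor
        · intro hs
          rcases lt_trichotomy s.1.1 q.1.1 with h | h | h
          · exact Or.inl (Or.inl h)
          · exact Or.inr ⟨h, hs⟩
          · exact Or.inl (Or.inr h)
        · rintro ((h | h) | h)
          · rintro rfl; exact h.false
          · rintro rfl; exact h.false
          · exact h.2
      rw [h1]
      refine ((h.isOpen_Iio _).union (isOpen_Ioi mult P _)).union (isOpen_biUnion fun s hs => ?_)
      exact isOpen_singleton mult P s (by rw [hs.1]; exact hq)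
  · refine ⟨_, (h.isClopen_Iic r.1.1).compl, not_le.2 hgt, not_not.2 (le_refl r.1.1)⟩

/-- An ultrafilter on `K` that converges to no point of `F` avoids a neighbourhood of each of these
finitely many points, hence lives on a compact remainder. In the induction on height, `F` is the
finite top level. -/
theorem _root_.isCompact_of_finite_of_isCompact_diff {X : Type*} [TopologicalSpace X] {K F : Set X}
    (hF : F.Finite) (hFK : F ⊆ K) (h : ∀ V, IsOpen V → F ⊆ V → IsCompact (K \ V)) :
    IsCompact K := by
  rw [isCompact_iff_ultrafilter_le_nhds]
  intro f hf
  by_contra! hlim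
  have h1 : ∀ x ∈ F, ∃ V, IsOpen V ∧ x ∈ V ∧ V ∉ f := by
    intro x hx
    by_contra! h2
    refine hlim x (hFK hx) fun s hs => ?_
    obtain ⟨V, hVs, hV, hxV⟩ := mem_nhds_iff.1 hs
    exact Filter.mem_of_superset (h2 V hV hxV) hVs
  choose! V hV hxV hVf using h1
  have hVnot : (⋃ x ∈ F, V x) ∉ f := by
    rw [Ultrafilter.finite_biUnion_mem_iff hF]
    rintro ⟨x, hx, hxf⟩
    exact hVf x hx hxf
  have h3 : K \ ⋃ x ∈ F, V x ∈ f :=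
    Filter.inter_mem (Filter.le_principal_iff.1 hf) (Ultrafilter.compl_mem_iff_notMem.2 hVnot)
  obtain ⟨x, hx, hfx⟩ := isCompact_iff_ultrafilter_le_nhds.1
    (h _ (isOpen_biUnion hV) fun x hx => Set.mem_biUnion hx (hxV x hx)) f
    (Filter.le_principal_iff.2 h3)
  exact hlim x hx.1 hfx

theorem isCompact_Iic (h : IsSplitting mult P) (γ : Omega1) :
    @IsCompact _ (splitTopology mult P) {q : SplitPoint mult | q.1.1 ≤ γ} := by
  let _ := splitTopology mult P
  induction γ using WellFoundedLT.induction with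
  | ind γ ih =>
  refine isCompact_of_finite_of_isCompact_diff (finite_fiber mult γ) (fun q hq => le_of_eq hq)
    fun V hV hFV => ?_
  have hclosed : IsClosed ({q : SplitPoint mult | q.1.1 ≤ γ} \ V) :=
    (h.isClopen_Iic γ).1.sdiff hV
  by_cases hemp : {q : SplitPoint mult | q.1.1 ≤ γ} \ V = ∅
  · rw [hemp]
    exact isCompact_empty
  -- A leftover point supplies an ordinal below `γ`: a default bound for indices `i ≥ mult γ`, and a
  -- witness that a non-limit `γ` is a successor.
  obtain ⟨q₀, hq₀, hq₀V⟩ := Set.nonempty_iff_ne_empty.2 hemp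
  have hlt : ∀ q ∈ {q : SplitPoint mult | q.1.1 ≤ γ} \ V, q.1.1 < γ := fun q hq =>
    lt_of_le_of_ne hq.1 fun h => hq.2 (hFV h)
  suffices ∃ β < γ, ∀ q : SplitPoint mult, β < q.1.1 → q.1.1 < γ → q ∈ V by
    obtain ⟨β, hβ, hsub⟩ := this
    refine (ih β hβ).of_isClosed_subset hclosed fun q hq => ?_
    exact not_lt.1 fun hβq => hq.2 (hsub q hβq (hlt q hq))
  by_cases hγ : Order.IsSuccLimit γ
  · have h1 : ∀ i, ∃ β < γ, i < mult γ → ∀ r ∈ P γ i, β < r.1.1 → r ∈ V := by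
      intro i
      by_cases hi : i < mult γ
      · obtain ⟨β, hβ, hr⟩ := hV ⟨(γ, i), hi⟩ (hFV rfl) hγ
        exact ⟨β, hβ, fun _ => hr⟩
      · exact ⟨_, hlt q₀ ⟨hq₀, hq₀V⟩, fun h => absurd h hi⟩
    choose b hb hbV using h1
    refine ⟨(Finset.range (mult γ)).sup' ⟨0, Finset.mem_range.2 (h.pos γ)⟩ b, ?_, ?_⟩
    · exact (Finset.sup'_lt_iff _).2 fun i _ => hb i
    · intro q hq hqγ
      obtain ⟨i, hi, hqi⟩ := h.exists_mem hγ hqγ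
      exact hbV i hi q hqi ((Finset.le_sup' b (Finset.mem_range.2 hi)).trans_lt hq)
  · have hmin : ¬ IsMin γ := not_isMin_iff.2 ⟨_, hlt q₀ ⟨hq₀, hq₀V⟩⟩
    have hpre : ¬ Order.IsSuccPrelimit γ := fun hp => hγ ⟨hmin, hp⟩
    obtain ⟨β, hβ⟩ := Order.not_isSuccPrelimit_iff.1 hpre
    exact ⟨β, hβ.lt, fun q h1 h2 => absurd h2 (hβ.2 h1)⟩

theorem t2Space (h : IsSplitting mult P) : @T2Space _ (splitTopology mult P) := by
  let _ := splitTopology mult P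
  have := h.totallySeparatedSpace
  infer_instance

theorem locallyCompactSpace (h : IsSplitting mult P) :
    @LocallyCompactSpace _ (splitTopology mult P) := by
  let _ := splitTopology mult P
  have := h.t2Space
  have : WeaklyLocallyCompactSpace (SplitPoint mult) :=
    ⟨fun q => ⟨_, h.isCompact_Iic q.1.1, (h.isOpen_Iic q.1.1).mem_nhds (le_refl q.1.1)⟩⟩
  infer_instance

end IsSplitting

/-! ### Existence of the Dow–Junnila–Pelant construction -/

/-- Finitely many distinct points of a totally separated space are told apart by a locally constant
function. -/
theorem exists_isLocallyConstant_leftInverse {X J : Type*} [TopologicalSpace X]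
    [TotallySeparatedSpace X] [Finite J] [Nonempty J] {q : J → X} (hq : Function.Injective q) :
    ∃ e : X → J, IsLocallyConstant e ∧ ∀ j, e (q j) = j := by
  classical
  have h1 : ∀ i j, ∃ E : Set X, IsClopen E ∧ (i ≠ j → q i ∈ E ∧ q j ∉ E) := by
    intro i j
    by_cases hij : i = j
    · exact ⟨∅, isClopen_empty, fun h => absurd hij h⟩
    · obtain ⟨E, hE, h⟩ := exists_isClopen_of_totally_separated (hq.ne hij)
      exact ⟨E, hE, fun _ => h⟩
  choose E hE hqE using h1
  -- `Φ` records the membership of a point in all the separating clopen sets. The given points have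
  -- distinct records, so a record can be decoded to an index.
  let Φ : X → J → J → Bool := fun x i j => (E i j).boolIndicator x
  have hΦ : IsLocallyConstant Φ := by
    rw [IsLocallyConstant.iff_continuous]
    exact continuous_pi fun i => continuous_pi fun j =>
      (continuous_boolIndicator_iff_isClopen _).2 (hE i j)
  have hinj : Function.Injective (Φ ∘ q) := by
    intro i j hij
    by_contra hne
    have h2 := congrFun (congrFun hij i) j
    have h3 := (Set.mem_iff_boolIndicator _ _).1 (hqE i j hne).1
    exact (hqE i j hne).2 ((Set.mem_iff_boolIndicator _ _).2 (h2.symm.trans h3))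
  exact ⟨Function.invFun (Φ ∘ q) ∘ Φ, hΦ.comp _, Function.leftInverse_invFun hinj⟩

theorem List.exists_forall_fst_le {s : List (Omega1 × ℕ)} (hs : s ≠ []) :
    ∃ p ∈ s, ∀ p' ∈ s, p'.1 ≤ p.1 := by
  obtain ⟨p, hp, hmax⟩ := s.toFinset.exists_max_image Prod.fst (by simpa using hs)
  exact ⟨p, by simpa using hp, fun p' hp' => hmax p' (by simpa using hp')⟩

/-- The largest heights of the tuples in `T` have only finitely many values below any `α < γ`, so
they cut the space below `γ` into clopen blocks, each containing one tuple. Locally constant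
colourings that separate the terms of each tuple are glued along the blocks. -/
theorem IsSplitting.exists_partition {mult : Omega1 → ℕ}
    {P : Omega1 → ℕ → Set (SplitPoint mult)} (h : IsSplitting mult P) {γ : Omega1}
    {T : Set (List (Omega1 × ℕ))} (hT : IsConvergent γ T) {m : ℕ} (hm0 : 0 < m)
    (hm : ∀ s ∈ T, s.length = m ∧ s.Nodup ∧ ∀ p ∈ s, p.2 < mult p.1) :
    ∃ p : ℕ → Set (SplitPoint mult), (∀ i, IsOpen[splitTopology mult P] (p i)) ∧
      (∀ i j, i ≠ j → Disjoint (p i) (p j)) ∧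
      ⋃ i ∈ Set.Iio m, p i = {q : SplitPoint mult | q.1.1 < γ} ∧
      ∀ s ∈ T, ∀ i < m, ∃ q ∈ p i, s[i]? = some q.1 := by
  let _ := splitTopology mult P
  have := h.totallySeparatedSpace
  have : NeZero m := ⟨hm0.ne'⟩
  have hne : ∀ s ∈ T, s ≠ [] := by
    rintro s hs rfl
    exact hm0.ne (hm _ hs).1
  choose! M hMs hM using fun s (hs : s ∈ T) => List.exists_forall_fst_le (hne s hs)
  have hMinj : ∀ s ∈ T, ∀ t ∈ T, (M s).1 = (M t).1 → s = t := fun s hs t ht hst =>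
    hT.consecutive.eq_of_mem hs ht (hMs s hs) (hMs t ht) hst
  have hcol : ∀ s ∈ T, ∃ e : SplitPoint mult → Fin m, IsLocallyConstant e ∧
      ∀ i : Fin m, ∃ q, s[i.1]? = some q.1 ∧ e q = i := by
    intro s hs
    obtain ⟨hlen, hnodup, hmem⟩ := hm s hs
    let q : Fin m → SplitPoint mult := fun i =>
      ⟨s[i.1]'(hlen ▸ i.2), hmem _ (List.getElem_mem _)⟩
    have hq : Function.Injective q := fun i j hij =>
      Fin.ext ((hnodup.getElem_inj_iff).1 (congrArg Subtype.val hij))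
    obtain ⟨e, he, heq⟩ := exists_isLocallyConstant_leftInverse hq
    exact ⟨e, he, fun i => ⟨q i, List.getElem?_eq_getElem _, heq i⟩⟩
  choose! e he hes using hcol
  -- `g α` is the tuple with the least top height that is at least `α`, so it names the block of
  -- `α`.
  have hg : ∀ α, α < γ → ∃ s ∈ T, α ≤ (M s).1 ∧ ∀ t ∈ T, α ≤ (M t).1 → (M s).1 ≤ (M t).1 := by
    intro α hα
    have hnon : {s ∈ T | α ≤ (M s).1}.Nonempty := by
      obtain ⟨s, hs, hs'⟩ := (hT.infinite.sdiff (hT.converges α hα)).nonempty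
      exact ⟨s, hs, not_lt.1 fun hlt => hs' ⟨hs, _, hMs s hs, hlt.le⟩⟩
    obtain ⟨β, ⟨s, hs, rfl⟩, hmin⟩ := (wellFounded_lt (α := Omega1)).has_min
      ((fun s => (M s).1) '' {s ∈ T | α ≤ (M s).1}) (hnon.image _)
    exact ⟨s, hs.1, hs.2, fun t ht hαt => not_lt.1 (hmin _ ⟨t, ⟨ht, hαt⟩, rfl⟩)⟩
  choose! g hgT hgle hgmin using hg
  let c : SplitPoint mult → Fin m := fun q => e (g q.1.1) q
  -- Near `q`, heights stay at most that of `q` and above the finitely many earlier block ends, so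
  -- the block does not change.
  have hc : ∀ q : SplitPoint mult, q.1.1 < γ → ∀ᶠ r in 𝓝 q, c r = c q := by
    intro q hq
    have hfin : {s ∈ T | (M s).1 < q.1.1}.Finite :=
      (hT.converges _ hq).subset fun s hs => ⟨hs.1, _, hMs s hs.1, hs.2.le⟩
    have hN : ∀ᶠ r : SplitPoint mult in 𝓝 q, ∀ s ∈ {s ∈ T | (M s).1 < q.1.1}, (M s).1 < r.1.1 :=
      (Filter.eventually_all_finite hfin).2 fun s hs =>
        (IsSplitting.isOpen_Ioi mult P (M s).1).mem_nhds hs.2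
    have hle : ∀ᶠ r : SplitPoint mult in 𝓝 q, r.1.1 ≤ q.1.1 :=
      (h.isOpen_Iic q.1.1).mem_nhds (le_refl q.1.1)
    filter_upwards [hN, hle, (IsLocallyConstant.iff_eventually_eq _).1 (he _ (hgT _ hq)) q] with
      r hr hrq her
    have hrγ := hrq.trans_lt hq
    have hgr : g r.1.1 = g q.1.1 := by
      refine hMinj _ (hgT _ hrγ) _ (hgT _ hq) (le_antisymm ?_ ?_)
      · exact hgmin _ hrγ _ (hgT _ hq) (hrq.trans (hgle _ hq))
      · refine hgmin _ hq _ (hgT _ hrγ) (not_lt.1 fun hlt => ?_)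
        exact (hr _ ⟨hgT _ hrγ, hlt⟩).not_ge (hgle _ hrγ)
    show e (g r.1.1) r = e (g q.1.1) q
    rw [hgr, her]
  refine ⟨fun i => {q | q.1.1 < γ ∧ (c q).1 = i}, fun i => ?_, fun i j hij => ?_, ?_, ?_⟩
  · rw [isOpen_iff_mem_nhds]
    rintro q ⟨hq, hqi⟩
    filter_upwards [hc q hq, (h.isOpen_Iio γ).mem_nhds hq] with r hr hrγ
    exact ⟨hrγ, hr ▸ hqi⟩
  · rw [Set.disjoint_left]
    rintro q ⟨-, hi⟩ ⟨-, hj⟩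
    exact hij (hi.symm.trans hj)
  · ext q
    simp only [Set.mem_iUnion, Set.mem_Iio, Set.mem_ofPred_eq]
    exact ⟨fun ⟨_, _, hq, _⟩ => hq, fun hq => ⟨_, (c q).2, hq, rfl⟩⟩
  · intro s hs i hi
    obtain ⟨q, hqs, hqi⟩ := hes s hs ⟨i, hi⟩
    have hmem : q.1 ∈ s := List.mem_of_getElem? hqs
    have hqγ := hT.lt s hs _ hmem
    refine ⟨q, ⟨hqγ, ?_⟩, hqs⟩
    -- A tuple before `s` ends below the term `q`, and one after `s` is not the first to reach it.
    have hgs : g q.1.1 = s := by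
      by_contra hne
      rcases hT.consecutive _ (hgT _ hqγ) _ hs hne with hlt | hlt
      · exact (hlt _ (hMs _ (hgT _ hqγ)) _ hmem).not_ge (hgle _ hqγ)
      · exact (hlt _ (hMs _ (hgT _ hqγ)) _ (hMs _ hs)).not_ge (hgmin _ hqγ _ hs (hM _ hs _ hmem))
    show (e (g q.1.1) q).1 = i
    rw [hgs, hqi]

/-- Openness of `U` involves only the pieces at heights occurring in `U`. Hence openness below `γ`
can be checked before the later pieces are chosen. -/
theorem isOpen_splitTopology_congr {mult : Omega1 → ℕ} {P Q : Omega1 → ℕ → Set (SplitPoint mult)}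
    {U : Set (SplitPoint mult)} (hPQ : ∀ q ∈ U, P q.1.1 = Q q.1.1)
    (hU : IsOpen[splitTopology mult P] U) : IsOpen[splitTopology mult Q] U := by
  intro q hq hlim
  obtain ⟨β, hβ, hsub⟩ := hU q hq hlim
  exact ⟨β, hβ, fun r hr => hsub r (hPQ q hq ▸ hr)⟩

theorem IsTupleGuess.congr {S : Omega1 → Set (List (Omega1 × ℕ))} {mult mult' : Omega1 → ℕ}
    {γ : Omega1} {m : ℕ} (hS : ∀ s ∈ S γ, ∀ p ∈ s, p.1 < γ) (hmult : ∀ δ < γ, mult δ = mult' δ)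
    (h : IsTupleGuess S mult γ m) : IsTupleGuess S mult' γ m :=
  ⟨h.1, fun s hs => ⟨(h.2 s hs).1, (h.2 s hs).2.1, fun p hp =>
    hmult _ (hS s hs p hp) ▸ (h.2 s hs).2.2 p hp⟩⟩

theorem IsTupleGuess.unique {S : Omega1 → Set (List (Omega1 × ℕ))} {mult mult' : Omega1 → ℕ}
    {γ : Omega1} {m m' : ℕ} (hS : (S γ).Nonempty) (h : IsTupleGuess S mult γ m)
    (h' : IsTupleGuess S mult' γ m') : m = m' := by
  obtain ⟨s, hs⟩ := hS
  exact (h.2 s hs).1.symm.trans (h'.2 s hs).1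

theorem IsGuessing.isConvergent {S : Omega1 → Set (List (Omega1 × ℕ))} (hS : IsGuessing S)
    {γ : Omega1} (hγ : Order.IsSuccLimit γ) : IsConvergent γ (S γ) :=
  ⟨hS.lt γ hγ, hS.infinite γ hγ, hS.consecutive γ hγ, hS.converges γ hγ⟩

/-- The multiplicities do not depend on the pieces, so they are found by a separate recursion; this
fixes the underlying set before any topology is chosen. -/
theorem IsGuessing.exists_mult {S : Omega1 → Set (List (Omega1 × ℕ))} (hS : IsGuessing S) :
    ∃ mult : Omega1 → ℕ, (∀ γ, ¬ Order.IsSuccLimit γ → mult γ = 1) ∧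
      (∀ γ, Order.IsSuccLimit γ → ∀ m, IsTupleGuess S mult γ m → mult γ = m) ∧
      ∀ γ, Order.IsSuccLimit γ → (¬ ∃ m, IsTupleGuess S mult γ m) → mult γ = 1 := by
  classical
  obtain ⟨mult, hmult⟩ := Omega1.exists_recursive (fun _ => 1) fun γ f =>
    if h : Order.IsSuccLimit γ ∧ ∃ m, IsTupleGuess S f γ m then h.2.choose else 1
  have hto : ∀ γ, Order.IsSuccLimit γ → ∀ m, IsTupleGuess S mult γ m →
      IsTupleGuess S (fun δ => if δ < γ then mult δ else 1) γ m := fun γ hγ m h =>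
    h.congr (hS.lt γ hγ) fun δ hδ => by simp [hδ]
  have hfrom : ∀ γ, Order.IsSuccLimit γ → ∀ m,
      IsTupleGuess S (fun δ => if δ < γ then mult δ else 1) γ m →
      IsTupleGuess S mult γ m := fun γ hγ m h =>
    h.congr (hS.lt γ hγ) fun δ hδ => by simp [hδ]
  refine ⟨mult, fun γ hγ => ?_, fun γ hγ m hm => ?_, fun γ hγ hno => ?_⟩
  · rw [hmult, dif_neg fun h => hγ h.1]
  · have h : Order.IsSuccLimit γ ∧ ∃ m, IsTupleGuess S (fun δ => if δ < γ then mult δ else 1) γ m :=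
      ⟨hγ, m, hto γ hγ m hm⟩
    rw [hmult, dif_pos h]
    exact h.2.choose_spec.unique (hS.infinite γ hγ).nonempty hm
  · rw [hmult, dif_neg]
    rintro ⟨-, m, hm⟩
    exact hno ⟨m, hfrom γ hγ m hm⟩

theorem mult_pos {S : Omega1 → Set (List (Omega1 × ℕ))} {mult : Omega1 → ℕ}
    (h1 : ∀ γ, ¬ Order.IsSuccLimit γ → mult γ = 1)
    (h2 : ∀ γ, Order.IsSuccLimit γ → ∀ m, IsTupleGuess S mult γ m → mult γ = m)
    (h3 : ∀ γ, Order.IsSuccLimit γ → (¬ ∃ m, IsTupleGuess S mult γ m) → mult γ = 1)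
    (γ : Omega1) : 0 < mult γ := by
  by_cases hγ : Order.IsSuccLimit γ
  · by_cases hm : ∃ m, IsTupleGuess S mult γ m
    · obtain ⟨m, hm⟩ := hm
      rw [h2 γ hγ m hm]
      exact hm.1
    · simp [h3 γ hγ hm]
  · simp [h1 γ hγ]

theorem DJPConstruction.isSplitting {S : Omega1 → Set (List (Omega1 × ℕ))}
    (D : DJPConstruction S) : IsSplitting D.mult D.piece :=
  ⟨mult_pos D.mult_of_not_limit D.mult_of_guess D.mult_of_no_guess, D.piece_isOpen,
    D.piece_disjoint, D.piece_cover⟩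

/-- The partition of the part below `γ` into one piece. -/
def trivialPiece (mult : Omega1 → ℕ) (γ : Omega1) (i : ℕ) : Set (SplitPoint mult) :=
  {q | q.1.1 < γ ∧ i = 0}

theorem IsGuessing.nonempty_djpConstruction {S : Omega1 → Set (List (Omega1 × ℕ))}
    (hS : IsGuessing S) : Nonempty (DJPConstruction S) := by
  classical
  obtain ⟨mult, h1, h2, h3⟩ := hS.exists_mult
  have hpos := mult_pos h1 h2 h3
  let Good (γ : Omega1) (Q : Omega1 → ℕ → Set (SplitPoint mult))
      (p : ℕ → Set (SplitPoint mult)) : Prop :=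
    (∀ i < mult γ, IsOpen[splitTopology mult Q] (p i)) ∧
    (∀ i < mult γ, ∀ j < mult γ, i ≠ j → Disjoint (p i) (p j)) ∧
    ⋃ i ∈ Set.Iio (mult γ), p i = {q : SplitPoint mult | q.1.1 < γ} ∧
    ∀ m, IsTupleGuess S mult γ m → ∀ i < m, {s ∈ S γ | ¬ ∃ q ∈ p i, s[i]? = some q.1}.Finite
  obtain ⟨piece, hpiece⟩ := Omega1.exists_recursive (trivialPiece mult) fun γ Q =>
    if h : ∃ p, Good γ Q p then h.choose else trivialPiece mult γ
  -- Trivial pieces fill the stages from `γ` on, so that each partial construction is a splitting of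
  -- the whole set and `exists_partition` applies.
  let trunc (γ : Omega1) : Omega1 → ℕ → Set (SplitPoint mult) :=
    fun δ => if δ < γ then piece δ else trivialPiece mult δ
  have hsub : ∀ γ Q p, Good γ Q p → ∀ i < mult γ, ∀ q ∈ p i, q.1.1 < γ := by
    rintro γ Q p ⟨-, -, hcov, -⟩ i hi q hq
    have : q ∈ {q : SplitPoint mult | q.1.1 < γ} := by
      rw [← hcov]
      exact Set.mem_biUnion (show i ∈ Set.Iio (mult γ) from hi) hq
    exact this
  have hdisj : ∀ γ i j, i ≠ j → Disjoint (trivialPiece mult γ i) (trivialPiece mult γ j) := by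
    intro γ i j hij
    rw [Set.disjoint_left]
    rintro q ⟨-, hi⟩ ⟨-, hj⟩
    exact hij (hi.trans hj.symm)
  have hcov : ∀ γ, ⋃ i ∈ Set.Iio (mult γ), trivialPiece mult γ i =
      {q : SplitPoint mult | q.1.1 < γ} := by
    intro γ
    ext q
    simp only [trivialPiece, Set.mem_iUnion, Set.mem_Iio, Set.mem_ofPred_eq]
    exact ⟨fun ⟨_, _, hq, _⟩ => hq, fun hq => ⟨0, hpos γ, hq, rfl⟩⟩
  have hgood : ∀ γ, Order.IsSuccLimit γ → Good γ (trunc γ) (piece γ) := by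
    intro γ
    induction γ using WellFoundedLT.induction with
    | ind γ ih =>
    intro hγ
    have hlt : ∀ δ, Order.IsSuccLimit δ → ∀ i < mult δ, ∀ q ∈ trunc γ δ i, q.1.1 < δ := by
      intro δ hδ i hi q hq
      by_cases hδγ : δ < γ
      · simp only [trunc, if_pos hδγ] at hq
        exact hsub _ _ _ (ih δ hδγ hδ) i hi q hq
      · simp only [trunc, if_neg hδγ] at hq
        exact hq.1
    have htriv : ∀ δ i, IsOpen[splitTopology mult (trunc γ)] (trivialPiece mult δ i) := by
      rintro δ i q ⟨hq, rfl⟩ hlim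
      obtain ⟨β, hβ⟩ := not_isMin_iff.1 hlim.1
      exact ⟨β, hβ, fun r hr _ => ⟨(hlt _ hlim _ q.2 r hr).trans hq, rfl⟩⟩
    have hsplit : IsSplitting mult (trunc γ) := by
      refine ⟨hpos, fun δ hδ i hi => ?_, fun δ hδ => ?_, fun δ hδ => ?_⟩
      · by_cases hδγ : δ < γ
        · have hg := ih δ hδγ hδ
          simp only [trunc, if_pos hδγ]
          refine isOpen_splitTopology_congr (fun q hq => ?_) (hg.1 i hi)
          have hqδ := hsub _ _ _ hg i hi q hq
          simp only [trunc, if_pos hqδ, if_pos (hqδ.trans hδγ)]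
        · simpa only [trunc, if_neg hδγ] using htriv δ i
      · by_cases hδγ : δ < γ
        · simpa only [trunc, if_pos hδγ] using (ih δ hδγ hδ).2.1
        · simpa only [trunc, if_neg hδγ] using fun i _ j _ => hdisj δ i j
      · by_cases hδγ : δ < γ
        · simpa only [trunc, if_pos hδγ] using (ih δ hδγ hδ).2.2.1
        · simpa only [trunc, if_neg hδγ] using hcov δ
    have hex : ∃ p, Good γ (trunc γ) p := by
      by_cases hm : ∃ m, IsTupleGuess S mult γ m
      · obtain ⟨m, hm⟩ := hm
        obtain ⟨p, hp1, hp2, hp3, hp4⟩ :=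
          hsplit.exists_partition (hS.isConvergent hγ) hm.1 hm.2
        refine ⟨p, fun i _ => hp1 i, fun i _ j _ => hp2 i j, ?_, fun m' hm' i hi => ?_⟩
        · rw [h2 γ hγ m hm, hp3]
        · obtain rfl := hm'.unique (hS.infinite γ hγ).nonempty hm
          convert Set.finite_empty
          ext s
          simp only [Set.mem_ofPred_eq, Set.mem_empty_iff_false, iff_false, not_and, not_not]
          exact fun hs => hp4 s hs i hi
      · exact ⟨trivialPiece mult γ, fun i _ => htriv γ i, fun i _ j _ => hdisj γ i j, hcov γ,
          fun m hm' => absurd ⟨m, hm'⟩ hm⟩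
    rw [hpiece γ, dif_pos hex]
    exact hex.choose_spec
  exact ⟨mult, piece, h1, h2, h3, fun γ hγ i hi =>
    isOpen_splitTopology_congr (fun q hq => by
      simp only [trunc, if_pos (hsub _ _ _ (hgood γ hγ) i hi q hq)]) ((hgood γ hγ).1 i hi),
    fun γ hγ => (hgood γ hγ).2.1, fun γ hγ => (hgood γ hγ).2.2.1, fun γ hγ => (hgood γ hγ).2.2.2⟩

/-! ### Functionals on spaces of continuous functions on scattered compact spaces -/

section Functional

variable {X : Type*} [TopologicalSpace X]

/-- The restriction of a continuous function to a clopen set, extended by zero. -/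
noncomputable def ContinuousMap.clopenIndicator (f : C(X, ℝ)) {U : Set X} (hU : IsClopen U) :
    C(X, ℝ) :=
  ⟨U.indicator f, f.continuous.indicator fun x hx => by simp [hU.frontier_eq] at hx⟩

theorem ContinuousMap.clopenIndicator_apply (f : C(X, ℝ)) {U : Set X} (hU : IsClopen U) (x : X) :
    f.clopenIndicator hU x = U.indicator f x := rfl

theorem ContinuousMap.clopenIndicator_add_compl (f : C(X, ℝ)) {U : Set X} (hU : IsClopen U) :
    f.clopenIndicator hU + f.clopenIndicator hU.compl = f := by
  ext x
  exact congrFun (Set.indicator_self_add_compl U f) x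

theorem eventuallyEq_zero_clopenIndicator {f : C(X, ℝ)} {U : Set X} (hU : IsClopen U) {x : X}
    (h : f =ᶠ[𝓝 x] 0) : f.clopenIndicator hU =ᶠ[𝓝 x] 0 := by
  filter_upwards [h] with y hy
  rw [ContinuousMap.clopenIndicator_apply]
  by_cases hyU : y ∈ U
  · rw [Set.indicator_of_mem hyU, hy]
  · rw [Set.indicator_of_notMem hyU]
    rfl

variable [CompactSpace X]

theorem ContinuousMap.norm_clopenIndicator_le (f : C(X, ℝ)) {U : Set X} (hU : IsClopen U) :
    ‖f.clopenIndicator hU‖ ≤ ‖f‖ :=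
  (ContinuousMap.norm_le _ (norm_nonneg f)).2 fun x =>
    (norm_indicator_le_norm_self _ _).trans (f.norm_coe_le_norm x)

variable (μ : C(X, ℝ) →L[ℝ] ℝ)

/-- Up to any error, the functional is determined on functions supported in `U` by the values near a
finite set. -/
def SmallOffFinite (U : Set X) : Prop :=
  ∀ η > 0, ∃ F : Set X, F.Finite ∧ ∀ f : C(X, ℝ), ‖f‖ ≤ 1 → (∀ x ∉ U, f x = 0) →
    (∀ x ∈ F, f =ᶠ[𝓝 x] 0) → |μ f| ≤ η

variable {μ}

theorem SmallOffFinite.mono {U V : Set X} (h : SmallOffFinite μ V) (hUV : U ⊆ V) :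
    SmallOffFinite μ U := by
  intro η hη
  obtain ⟨F, hF, h⟩ := h η hη
  exact ⟨F, hF, fun f hf hfU => h f hf fun x hx => hfU x fun hxU => hx (hUV hxU)⟩

/-- The function is cut along the clopen set `U`, and the error is shared between the two parts. -/
theorem SmallOffFinite.union {U V : Set X} (hU : IsClopen U) (h : SmallOffFinite μ U)
    (h' : SmallOffFinite μ V) : SmallOffFinite μ (U ∪ V) := by
  intro η hη
  obtain ⟨F, hF, h⟩ := h (η / 2) (half_pos hη)
  obtain ⟨F', hF', h'⟩ := h' (η / 2) (half_pos hη)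
  refine ⟨F ∪ F', hF.union hF', fun f hf hfU hfF => ?_⟩
  have h1 := h (f.clopenIndicator hU) ((f.norm_clopenIndicator_le hU).trans hf)
    (fun x hx => Set.indicator_of_notMem hx _)
    fun x hx => eventuallyEq_zero_clopenIndicator hU (hfF x (Or.inl hx))
  have h2 := h' (f.clopenIndicator hU.compl) ((f.norm_clopenIndicator_le hU.compl).trans hf)
    (fun x hx => by
      rw [ContinuousMap.clopenIndicator_apply]
      by_cases hxU : x ∈ U
      · exact Set.indicator_of_notMem (not_not.2 hxU) _
      · rw [Set.indicator_of_mem (show x ∈ Uᶜ from hxU)]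
        exact hfU x (not_or.2 ⟨hxU, hx⟩))
    fun x hx => eventuallyEq_zero_clopenIndicator hU.compl (hfF x (Or.inr hx))
  rw [← f.clopenIndicator_add_compl hU, map_add]
  linarith [abs_add_le (μ (f.clopenIndicator hU)) (μ (f.clopenIndicator hU.compl))]

theorem SmallOffFinite.of_isCompact {K : Set X} (hK : IsCompact K)
    (h : ∀ x ∈ K, ∃ U, IsClopen U ∧ x ∈ U ∧ SmallOffFinite μ U) : SmallOffFinite μ K := by
  obtain ⟨U, -, hKU, hU⟩ : ∃ U, IsClopen U ∧ K ⊆ U ∧ SmallOffFinite μ U := by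
    refine hK.induction_on (p := fun K => ∃ U, IsClopen U ∧ K ⊆ U ∧ SmallOffFinite μ U)
      ⟨∅, isClopen_empty, subset_rfl, fun η hη => ⟨∅, Set.finite_empty, fun f _ hf _ => ?_⟩⟩
      (fun s t hst ⟨U, hU, htU, hs⟩ => ⟨U, hU, hst.trans htU, hs⟩) ?_ ?_
    · have : f = 0 := by
        ext x
        exact hf x (Set.notMem_empty x)
      simp [this, hη.le]
    · rintro s t ⟨U, hU, hsU, h1⟩ ⟨V, hV, htV, h2⟩
      exact ⟨U ∪ V, hU.union hV, Set.union_subset_union hsU htV, h1.union hU h2⟩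
    · intro x hx
      obtain ⟨U, hU, hxU, h1⟩ := h x hx
      exact ⟨U, mem_nhdsWithin_of_mem_nhds (hU.2.mem_nhds hxU), U, hU, subset_rfl, h1⟩
  exact hU.mono hKU

/-- Near any set, but off it, a functional is small. -/
theorem exists_isOpen_abs_le (μ : C(X, ℝ) →L[ℝ] ℝ) (F : Set X) {η : ℝ}
    (hη : 0 < η) : ∃ V, IsOpen V ∧ F ⊆ V ∧ ∀ f : C(X, ℝ), ‖f‖ ≤ 1 → (∀ x ∉ V, f x = 0) →
      (∀ x ∈ F, f =ᶠ[𝓝 x] 0) → |μ f| ≤ η := by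
  by_contra! hcon
  -- Otherwise functions with disjoint supports can be added one after another: each new one lives
  -- where the sum so far vanishes. The norm stays at most `1` while `μ` grows by `η` each time,
  -- against boundedness.
  have key : ∀ k : ℕ, ∃ g : C(X, ℝ), ‖g‖ ≤ 1 ∧ (∀ x ∈ F, g =ᶠ[𝓝 x] 0) ∧ k * η ≤ μ g := by
    intro k
    induction k with
    | zero => exact ⟨0, by simp, fun x _ => Filter.EventuallyEq.rfl, by simp⟩
    | succ k ih =>
      obtain ⟨g, hg1, hgF, hgk⟩ := ih
      obtain ⟨f, hf1, hfV, hfF, hf⟩ := hcon (interior {x | g x = 0}) isOpen_interior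
        fun x hx => mem_interior_iff_mem_nhds.2 (hgF x hx)
      have hs : ∃ s : ℝ, |s| = 1 ∧ η ≤ s * μ f := by
        rcases le_total 0 (μ f) with h | h
        · exact ⟨1, by simp, by rw [abs_of_nonneg h] at hf; linarith⟩
        · exact ⟨-1, by simp, by rw [abs_of_nonpos h] at hf; linarith⟩
      obtain ⟨s, hs1, hs⟩ := hs
      refine ⟨g + s • f, (ContinuousMap.norm_le _ zero_le_one).2 fun x => ?_, fun x hx => ?_, ?_⟩
      · by_cases hx : x ∈ interior {x | g x = 0}
        · have h0 : g x = 0 := interior_subset (s := {x | g x = 0}) hx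
          simp only [ContinuousMap.add_apply, h0, ContinuousMap.smul_apply, zero_add, norm_smul,
            Real.norm_eq_abs s, hs1, one_mul]
          exact (f.norm_coe_le_norm x).trans hf1
        · simp only [ContinuousMap.add_apply, hfV x hx, ContinuousMap.smul_apply, smul_zero,
            add_zero]
          exact (g.norm_coe_le_norm x).trans hg1
      · filter_upwards [hgF x hx, hfF x hx] with y hy hy'
        simp [hy, hy']
      · rw [map_add, map_smul, smul_eq_mul]
        push_cast
        linarith
  obtain ⟨k, hk⟩ := exists_nat_gt (‖μ‖ / η)
  obtain ⟨g, hg1, -, hg⟩ := key k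
  have h1 : μ g ≤ ‖μ‖ * 1 := (le_abs_self _).trans (μ.le_opNorm_of_le hg1)
  rw [div_lt_iff₀ hη] at hk
  linarith

variable [T2Space X] [TotallyDisconnectedSpace X] {I : Type*} [PartialOrder I] [WellFoundedLT I]
  {ψ : X → I}

theorem exists_isClopen_between {F V : Set X} (hF : F.Finite) (hV : IsOpen V) (hFV : F ⊆ V) :
    ∃ W, IsClopen W ∧ F ⊆ W ∧ W ⊆ V := by
  have h1 : ∀ x ∈ F, ∃ W, IsClopen W ∧ x ∈ W ∧ W ⊆ V := fun x hx =>
    compact_exists_isClopen_in_isOpen hV (hFV hx)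
  choose! W hW hxW hWV using h1
  exact ⟨⋃ x ∈ F, W x, hF.isClopen_biUnion hW, fun x hx => Set.mem_biUnion hx (hxW x hx),
    Set.iUnion₂_subset hWV⟩

/-- Induction on `i`: the part near the finite fibre over `i` is handled by `exists_isOpen_abs_le`,
and the rest is compact and covered by clopen sets of smaller index. -/
theorem smallOffFinite_of_wellFounded (hψ : ∀ i, IsClopen {x | ψ x ≤ i})
    (hfin : ∀ i, (ψ ⁻¹' {i}).Finite) (μ : C(X, ℝ) →L[ℝ] ℝ) (i : I) :
    SmallOffFinite μ {x | ψ x ≤ i} := by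
  induction i using WellFoundedLT.induction with
  | ind i ih =>
  intro η hη
  obtain ⟨V, hV, hFV, hVη⟩ := exists_isOpen_abs_le μ (ψ ⁻¹' {i}) (half_pos hη)
  obtain ⟨W, hW, hFW, hWV⟩ := exists_isClopen_between (hfin i) hV hFV
  have hsm : SmallOffFinite μ ({x | ψ x ≤ i} \ W) := by
    refine SmallOffFinite.of_isCompact ((hψ i).diff hW).1.isCompact fun x hx => ?_
    exact ⟨_, hψ (ψ x), le_refl (ψ x),
      ih _ (lt_of_le_of_ne hx.1 fun h => hx.2 (hFW h))⟩
  obtain ⟨F, hF, hFη⟩ := hsm (η / 2) (half_pos hη)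
  refine ⟨ψ ⁻¹' {i} ∪ F, (hfin i).union hF, fun f hf hfi hfF => ?_⟩
  have h1 := hVη (f.clopenIndicator hW) ((f.norm_clopenIndicator_le hW).trans hf)
    (fun x hx => Set.indicator_of_notMem (fun h => hx (hWV h)) _)
    fun x hx => eventuallyEq_zero_clopenIndicator hW (hfF x (Or.inl hx))
  have h2 := hFη (f.clopenIndicator hW.compl) ((f.norm_clopenIndicator_le hW.compl).trans hf)
    (fun x hx => by
      rw [ContinuousMap.clopenIndicator_apply]
      by_cases hxW : x ∈ W
      · exact Set.indicator_of_notMem (not_not.2 hxW) _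
      · rw [Set.indicator_of_mem (show x ∈ Wᶜ from hxW)]
        exact hfi x fun h => hx ⟨h, hxW⟩)
    fun x hx => eventuallyEq_zero_clopenIndicator hW.compl (hfF x (Or.inr hx))
  rw [← f.clopenIndicator_add_compl hW, map_add]
  linarith [abs_add_le (μ (f.clopenIndicator hW)) (μ (f.clopenIndicator hW.compl))]

/-- On bounded sets of continuous functions on a scattered compact space, functionals are continuous
for the topology of pointwise convergence. -/
theorem exists_finite_abs_lt (hψ : ∀ i, IsClopen {x | ψ x ≤ i})
    (hfin : ∀ i, (ψ ⁻¹' {i}).Finite) (μ : C(X, ℝ) →L[ℝ] ℝ) {M η : ℝ} (hM : 0 < M) (hη : 0 < η) :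
    ∃ F : Set X, F.Finite ∧ ∃ δ > 0, ∀ f : C(X, ℝ), ‖f‖ ≤ M → (∀ x ∈ F, |f x| < δ) →
      |μ f| < η := by
  have hsm : SmallOffFinite μ Set.univ :=
    SmallOffFinite.of_isCompact isCompact_univ fun x _ =>
      ⟨_, hψ (ψ x), le_refl (ψ x), smallOffFinite_of_wellFounded hψ hfin μ _⟩
  -- Rescaling to norm `1` costs the factor `M`. The part near `F` has norm at most `η / (2 * (‖μ‖ +
  -- 1))`, and the `+ 1` makes its contribution strictly less than `η / 2`.
  obtain ⟨F, hF, h⟩ := hsm (η / (2 * M)) (by positivity)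
  refine ⟨F, hF, η / (2 * (‖μ‖ + 1)), by positivity, fun f hf hfF => ?_⟩
  obtain ⟨W, hW, hFW, hWf⟩ := exists_isClopen_between (V := {x | |f x| < η / (2 * (‖μ‖ + 1))})
    hF (isOpen_lt (by fun_prop) continuous_const) hfF
  have h1 : ‖f.clopenIndicator hW‖ ≤ η / (2 * (‖μ‖ + 1)) := by
    refine (ContinuousMap.norm_le _ (by positivity)).2 fun x => ?_
    rw [ContinuousMap.clopenIndicator_apply]
    by_cases hx : x ∈ W
    · rw [Set.indicator_of_mem hx]
      exact (hWf hx).le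
    · rw [Set.indicator_of_notMem hx, norm_zero]
      positivity
  have h2 := h (M⁻¹ • f.clopenIndicator hW.compl) (by
      rw [norm_smul, norm_inv, Real.norm_of_nonneg hM.le, inv_mul_le_iff₀ hM, mul_one]
      exact (f.norm_clopenIndicator_le hW.compl).trans hf)
    (fun x hx => absurd (Set.mem_univ x) hx)
    fun x hx => by
      filter_upwards [hW.2.mem_nhds (hFW hx)] with y hy
      simp [ContinuousMap.clopenIndicator_apply, hy]
  have h3 : |μ (f.clopenIndicator hW)| < η / 2 := by
    calc |μ (f.clopenIndicator hW)| ≤ ‖μ‖ * (η / (2 * (‖μ‖ + 1))) := μ.le_opNorm_of_le h1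
      _ < (‖μ‖ + 1) * (η / (2 * (‖μ‖ + 1))) := by
          gcongr
          linarith
      _ = η / 2 := by
          have : ‖μ‖ + 1 ≠ 0 := by positivity
          field_simp
  have h4 : |μ (f.clopenIndicator hW.compl)| ≤ η / 2 := by
    rw [map_smul, smul_eq_mul, abs_mul, abs_inv, abs_of_pos hM, inv_mul_le_iff₀ hM] at h2
    calc _ ≤ _ := h2
      _ = η / 2 := by field_simp
  rw [← f.clopenIndicator_add_compl hW, map_add]
  linarith [abs_add_le (μ (f.clopenIndicator hW)) (μ (f.clopenIndicator hW.compl))]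

theorem WeakSpace.exists_finset_of_isOpen {E : Type*} [NormedAddCommGroup E] [NormedSpace ℝ E]
    {U : Set (WeakSpace ℝ E)} (hU : IsOpen U) {x : E} (hx : toWeakSpace ℝ E x ∈ U) :
    ∃ (Φ : Finset (E →L[ℝ] ℝ)) (ε : ℝ), 0 < ε ∧
      ∀ y, (∀ μ ∈ Φ, |μ (y - x)| < ε) → toWeakSpace ℝ E y ∈ U := by
  obtain ⟨V, hV, rfl⟩ := isOpen_induced_iff.1 hU
  obtain ⟨Φ, u, hu, hsub⟩ := isOpen_pi_iff.1 hV _ hx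
  have h1 : ∀ μ : E →L[ℝ] ℝ, ∃ ε > 0, μ ∈ Φ → ∀ y, |μ (y - x)| < ε → μ y ∈ u μ := by
    intro μ
    by_cases hμ : μ ∈ Φ
    · obtain ⟨ε, hε, hball⟩ := Metric.isOpen_iff.1 (hu μ hμ).1 _ (hu μ hμ).2
      refine ⟨ε, hε, fun _ y hy => hball ?_⟩
      rw [map_sub] at hy
      exact hy
    · exact ⟨1, one_pos, fun h => absurd h hμ⟩
  choose ε hε h1 using h1
  obtain ⟨ε₀, hε₀, hle⟩ : ∃ ε₀ > 0, ∀ μ ∈ Φ, ε₀ ≤ ε μ := by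
    rcases Φ.eq_empty_or_nonempty with rfl | hne
    · exact ⟨1, one_pos, by simp⟩
    · exact ⟨Φ.inf' hne ε, (Finset.lt_inf'_iff _).2 fun μ _ => hε μ, fun μ hμ => Φ.inf'_le _ hμ⟩
  exact ⟨Φ, ε₀, hε₀, fun y hy => hsub fun μ hμ => h1 μ hμ y ((hy μ hμ).trans_le (hle μ hμ))⟩

/-- On bounded sets of continuous functions on a scattered compact space, weakly open sets are open
for the topology of pointwise convergence. -/
theorem exists_finite_of_isOpen_weakSpace (hψ : ∀ i, IsClopen {x | ψ x ≤ i})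
    (hfin : ∀ i, (ψ ⁻¹' {i}).Finite) {U : Set (WeakSpace ℝ C(X, ℝ))} (hU : IsOpen U)
    {f : C(X, ℝ)} (hf : toWeakSpace ℝ _ f ∈ U) (M : ℝ) :
    ∃ F : Set X, F.Finite ∧ ∃ δ > 0, ∀ g : C(X, ℝ), ‖g‖ ≤ M → (∀ x ∈ F, |g x - f x| < δ) →
      toWeakSpace ℝ _ g ∈ U := by
  obtain ⟨Φ, ε, hε, h⟩ := WeakSpace.exists_finset_of_isOpen hU hf
  have hN : 0 < |M| + ‖f‖ + 1 := by positivity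
  have h1 : ∀ μ : C(X, ℝ) →L[ℝ] ℝ, _ := fun μ => exists_finite_abs_lt hψ hfin μ hN hε
  choose F hF δ hδ h1 using h1
  obtain ⟨δ₀, hδ₀, hle⟩ : ∃ δ₀ > 0, ∀ μ ∈ Φ, δ₀ ≤ δ μ := by
    rcases Φ.eq_empty_or_nonempty with rfl | hne
    · exact ⟨1, one_pos, by simp⟩
    · exact ⟨Φ.inf' hne δ, (Finset.lt_inf'_iff _).2 fun μ _ => hδ μ, fun μ hμ => Φ.inf'_le _ hμ⟩
  refine ⟨⋃ μ ∈ Φ, F μ, Φ.finite_toSet.biUnion fun μ _ => hF μ, δ₀, hδ₀, fun g hg hgf => ?_⟩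
  refine h g fun μ hμ => h1 μ (g - f) ?_ fun x hx => ?_
  · linarith [norm_sub_le g f, le_abs_self M]
  · exact (hgf x (Set.mem_biUnion hμ hx)).trans_le (hle μ hμ)

end Functional

/-! ### The Dow–Junnila–Pelant space -/

namespace DJPConstruction

variable {S : Omega1 → Set (List (Omega1 × ℕ))} (D : DJPConstruction S)

instance : TotallySeparatedSpace D.Points := D.isSplitting.totallySeparatedSpace

instance : T2Space D.Points := D.isSplitting.t2Space

instance : LocallyCompactSpace D.Points := D.isSplitting.locallyCompactSpace

variable {D}

/-- The ordinal of which a point is a part. -/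
def Points.height (q : D.Points) : Omega1 := q.1.1

theorem isClopen_height_le (β : Omega1) : IsClopen {q : D.Points | q.height ≤ β} :=
  D.isSplitting.isClopen_Iic β

theorem isCompact_height_le (β : Omega1) : IsCompact {q : D.Points | q.height ≤ β} :=
  D.isSplitting.isCompact_Iic β

theorem countable_height_le (β : Omega1) : {q : D.Points | q.height ≤ β}.Countable := by
  refine ((Omega1.countable_Iic β).biUnion fun α _ =>
    (IsSplitting.finite_fiber D.mult α).countable).mono ?_
  intro q hq
  exact Set.mem_biUnion (show Points.height q ∈ Set.Iic β from hq) rfl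

/-- The first point of which the ordinal `α` consists. -/
def Points.first (D : DJPConstruction S) (α : Omega1) : D.Points := ⟨(α, 0), D.isSplitting.pos α⟩

instance : NoncompactSpace D.Points := by
  refine ⟨fun hc => ?_⟩
  obtain ⟨β, hβ⟩ := hc.elim_directed_cover (fun β => {q : D.Points | Points.height q ≤ β})
    (fun β => (isClopen_height_le β).2) (fun q _ => Set.mem_iUnion.2 ⟨Points.height q, le_refl (Points.height q)⟩)
    (directed_of_isDirected_le fun _ _ h _ hq => le_trans hq h)
  obtain ⟨α, hα⟩ := exists_gt β
  exact hα.not_ge (hβ (Set.mem_univ (Points.first D α)))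

theorem isClopen_image_coe {C : Set D.Points} (hC : IsCompact C) (hC' : IsOpen C) :
    IsClopen ((↑) '' C : Set D.Space) :=
  ⟨(hC.image OnePoint.continuous_coe).isClosed, OnePoint.isOpen_image_coe.2 hC'⟩

instance : TotallySeparatedSpace D.Space := by
  rw [totallySeparatedSpace_iff_exists_isClopen]
  intro x y hxy
  have h0 : ∀ q : D.Points, ∃ U : Set D.Space, IsClopen U ∧ (q : D.Space) ∈ U ∧
      OnePoint.infty ∉ U := fun q =>
    ⟨_, isClopen_image_coe (isCompact_height_le q.height) (isClopen_height_le q.height).2,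
      ⟨q, le_refl q.height, rfl⟩, by simp⟩
  induction x using OnePoint.rec with
  | infty =>
    induction y using OnePoint.rec with
    | infty => exact absurd rfl hxy
    | coe r =>
      obtain ⟨U, hU, hr, hi⟩ := h0 r
      exact ⟨Uᶜ, hU.compl, hi, not_not.2 hr⟩
  | coe q =>
    induction y using OnePoint.rec with
    | infty => exact h0 q
    | coe r =>
      obtain ⟨E, hE, hq, hr⟩ :=
        exists_isClopen_of_totally_separated (fun h => hxy (congrArg _ h) : q ≠ r)
      refine ⟨_, isClopen_image_coe
        ((isCompact_height_le q.height).inter_right hE.1)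
        ((isClopen_height_le q.height).2.inter hE.2), ⟨q, ⟨le_refl q.height, hq⟩, rfl⟩, ?_⟩
      rintro ⟨s, ⟨-, hs⟩, hsr⟩
      exact hr (OnePoint.coe_injective hsr ▸ hs)

/-- The canonical map onto `[0, ω₁]`. -/
noncomputable def toOmega1Closed (x : D.Space) : Omega1Closed :=
  OnePoint.elim x (⟨Ordinal.omega 1, Set.mem_Iic.2 le_rfl⟩ : Omega1Closed) fun q : D.Points =>
    ⟨q.height.1, Set.mem_Iic.2 (le_of_lt (Set.mem_Iio.1 q.height.2))⟩

theorem isClopen_toOmega1Closed_le (a : Omega1Closed) :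
    IsClopen {x : D.Space | toOmega1Closed x ≤ a} := by
  rcases lt_or_eq_of_le (show a.1 ≤ _ from a.2) with ha | ha
  · convert isClopen_image_coe (D := D) (isCompact_height_le ⟨a.1, ha⟩)
      (isClopen_height_le ⟨a.1, ha⟩).2 using 1
    ext x
    induction x using OnePoint.rec with
    | infty =>
      simp only [Set.mem_ofPred_eq, OnePoint.infty_notMem_image_coe, iff_false, not_le]
      exact ha
    | coe q =>
      constructor
      · exact fun h => ⟨q, h, rfl⟩
      · rintro ⟨r, hr, hrq⟩
        exact OnePoint.coe_injective hrq ▸ hr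
  · convert isClopen_univ
    ext x
    simp only [Set.mem_ofPred_eq, Set.mem_univ, iff_true]
    exact show (toOmega1Closed x).1 ≤ a.1 from
      (Set.mem_Iic.1 (toOmega1Closed x).2).trans_eq ha.symm

theorem continuous_toOmega1Closed : Continuous (toOmega1Closed (D := D)) := by
  rw [OrderTopology.continuous_iff]
  intro a
  constructor
  · convert (isClopen_toOmega1Closed_le (D := D) a).compl.2 using 1
    ext x
    simp
  · have : toOmega1Closed ⁻¹' Set.Iio a =
        ⋃ b ∈ Set.Iio a, {x : D.Space | toOmega1Closed x ≤ b} := by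
      ext x
      simp only [Set.mem_preimage, Set.mem_Iio, Set.mem_iUnion, Set.mem_ofPred_eq, exists_prop]
      exact ⟨fun h => ⟨_, h, le_rfl⟩, fun ⟨b, hb, h⟩ => h.trans_lt hb⟩
    rw [this]
    exact isOpen_biUnion fun b _ => (isClopen_toOmega1Closed_le b).2

theorem surjective_toOmega1Closed : Function.Surjective (toOmega1Closed (D := D)) := by
  intro a
  rcases lt_or_eq_of_le (show a.1 ≤ _ from a.2) with ha | ha
  · exact ⟨(Points.first D ⟨a.1, ha⟩ : D.Space), rfl⟩
  · exact ⟨OnePoint.infty, Subtype.ext ha.symm⟩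

theorem finite_fiber_toOmega1Closed (a : Omega1Closed) :
    ((toOmega1Closed (D := D)) ⁻¹' {a}).Finite := by
  have hfin : {q : D.Points | q.height.1 = a.1}.Finite := by
    by_cases ha : a.1 < Ordinal.omega 1
    · refine (IsSplitting.finite_fiber D.mult ⟨a.1, ha⟩).subset fun q hq => ?_
      exact Subtype.ext hq
    · convert Set.finite_empty
      ext q
      simp only [Set.mem_ofPred_eq, Set.mem_empty_iff_false, iff_false]
      exact fun h => ha (h ▸ q.height.2)
  refine ((hfin.image ((↑) : D.Points → D.Space)).insert OnePoint.infty).subset fun x hx => ?_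
  induction x using OnePoint.rec with
  | infty => exact Or.inl rfl
  | coe q => exact Or.inr ⟨q, show q.height.1 = a.1 from congrArg Subtype.val hx, rfl⟩

/-- With the finiteness of fibres below, this makes the general results on functionals available for
powers, through the well-founded product order. -/
theorem isClopen_pi_toOmega1Closed_le (n : ℕ) (a : Fin n → Omega1Closed) :
    IsClopen {x : Fin n → D.Space | (fun j => toOmega1Closed (x j)) ≤ a} := by
  have : {x : Fin n → D.Space | (fun j => toOmega1Closed (x j)) ≤ a} =
      ⋂ j, (fun x => x j) ⁻¹' {x | toOmega1Closed x ≤ a j} := by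
    ext x
    simp [Pi.le_def]
  rw [this]
  exact isClopen_iInter_of_finite fun j =>
    (isClopen_toOmega1Closed_le (a j)).preimage (continuous_apply j)

theorem finite_fiber_pi_toOmega1Closed (n : ℕ) (a : Fin n → Omega1Closed) :
    ((fun (x : Fin n → D.Space) j => toOmega1Closed (x j)) ⁻¹' {a}).Finite := by
  refine (Set.Finite.pi' fun j => finite_fiber_toOmega1Closed (D := D) (a j)).subset ?_
  intro x hx j
  exact congrFun hx j

-- Functions with value `1` at infinity form a weakly closed set, covered by the weakly open
-- conditions of being positive at `q`. Countably many `q` lie below some `β`, and the indicator of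
-- the complement of that compact initial part escapes them all.
variable (D) in
theorem not_lindelofSpace : ¬ LindelofSpace (WeakSpace ℝ C(D.Space, ℝ)) := by
  intro hL
  have hcont : ∀ x : D.Space, Continuous fun f : WeakSpace ℝ C(D.Space, ℝ) =>
      (toWeakSpace ℝ C(D.Space, ℝ)).symm f x := fun x =>
    WeakBilin.eval_continuous _ (ContinuousMap.evalCLM ℝ x)
  have hF : IsClosed {f : WeakSpace ℝ C(D.Space, ℝ) |
      (toWeakSpace ℝ C(D.Space, ℝ)).symm f OnePoint.infty = 1} :=
    isClosed_eq (hcont _) continuous_const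
  obtain ⟨r, hr, hcov⟩ := hF.isLindelof.elim_countable_subcover
    (fun q : D.Points => {f : WeakSpace ℝ C(D.Space, ℝ) |
      0 < (toWeakSpace ℝ C(D.Space, ℝ)).symm f q})
    (fun q => isOpen_lt continuous_const (hcont q)) (fun f hf => by
      obtain ⟨q, hq⟩ := OnePoint.denseRange_coe.exists_mem_open
        (isOpen_lt continuous_const ((toWeakSpace ℝ C(D.Space, ℝ)).symm f).continuous)
        ⟨OnePoint.infty, show (0 : ℝ) < _ from (show _ = (1 : ℝ) from hf) ▸ one_pos⟩
      exact Set.mem_iUnion.2 ⟨q, hq⟩)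
  obtain ⟨β, hβ⟩ := Omega1.exists_gt_of_countable (hr.image Points.height)
  have hE : IsClopen ((↑) '' {q : D.Points | q.height ≤ β} : Set D.Space) :=
    isClopen_image_coe (isCompact_height_le β) (isClopen_height_le β).2
  have h1 := hcov (show toWeakSpace ℝ C(D.Space, ℝ)
      ((1 : C(D.Space, ℝ)).clopenIndicator hE.compl) ∈ _ by
    show (1 : C(D.Space, ℝ)).clopenIndicator hE.compl OnePoint.infty = 1
    rw [ContinuousMap.clopenIndicator_apply, Set.indicator_of_mem (by simp)]
    rfl)
  simp only [Set.mem_iUnion] at h1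
  obtain ⟨q, hq, h1⟩ := h1
  have h2 : (1 : C(D.Space, ℝ)).clopenIndicator hE.compl q = 0 := by
    rw [ContinuousMap.clopenIndicator_apply, Set.indicator_of_notMem]
    exact not_not.2 ⟨q, (hβ _ ⟨q, hq, rfl⟩).le, rfl⟩
  exact h1.ne' h2

end DJPConstruction

/-- Through the projection, the coordinates of `c₀(ω₁)` become weakly continuous on `X`. At each
point only finitely many exceed `1` in absolute value, and multiples of the unit vectors show that
the resulting open sets are distinct. -/
theorem WeaklyPcc.not_containsComplementedC0Omega1 {X : Type*} [NormedAddCommGroup X]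
    [NormedSpace ℝ X] (hX : WeaklyPcc X) : ¬ ContainsComplementedC0Omega1 X := by
  classical
  rintro ⟨Y, ⟨P, hP⟩, ⟨T⟩⟩
  let l : DiscreteOmega1 → WeakSpace ℝ X → ℝ := fun α x => T (P ((toWeakSpace ℝ X).symm x)) α
  have hl : ∀ α, Continuous (l α) := fun α => by
    let ev : C₀(DiscreteOmega1, ℝ) →L[ℝ] ℝ :=
      LinearMap.mkContinuous ⟨⟨fun f => f α, fun _ _ => rfl⟩, fun _ _ => rfl⟩ 1 fun f => by
        rw [one_mul]
        exact f.toBCF.norm_coe_le_norm α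
    exact WeakBilin.eval_continuous (topDualPairing ℝ X).flip
      (ev.comp ((T : Y →L[ℝ] C₀(DiscreteOmega1, ℝ)).comp P))
  have hsingle : ∀ α, ∃ x, ∀ β, l β x = if β = α then 2 else 0 := by
    intro α
    let e : C₀(DiscreteOmega1, ℝ) :=
      ⟨⟨fun β => if β = α then 2 else 0, continuous_of_discreteTopology⟩, by
      rw [Filter.cocompact_eq_cofinite]
      refine tendsto_const_nhds.congr' ?_
      filter_upwards [(Set.finite_singleton α).compl_mem_cofinite] with β hβ
      exact (if_neg hβ).symm⟩
    refine ⟨toWeakSpace ℝ X (T.symm e), fun β => ?_⟩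
    simp only [l, LinearEquiv.symm_apply_apply, hP, ContinuousLinearEquiv.apply_symm_apply]
    rfl
  choose x hx using hsingle
  let U : DiscreteOmega1 → Set (WeakSpace ℝ X) := fun α => {x | 1 < |l α x|}
  have hU : Function.Injective U := by
    intro α β h
    have h1 : x α ∈ U α := show 1 < |l α (x α)| by simp [hx]
    rw [h] at h1
    by_contra hne
    have h2 : 1 < |l β (x α)| := h1
    rw [hx, if_neg (Ne.symm hne)] at h2
    norm_num at h2
  have hc := hX (Set.range U) (by
    rintro _ ⟨α, rfl⟩
    exact isOpen_lt continuous_const (hl α).abs) fun x => by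
      have h1 := (T (P ((toWeakSpace ℝ X).symm x))).zero_at_infty'
      rw [Filter.cocompact_eq_cofinite] at h1
      have h2 : {α | 1 < |l α x|}.Finite := by
        have h3 := h1.abs.eventually (gt_mem_nhds (show |(0 : ℝ)| < 1 by simp))
        refine Set.Finite.subset (Filter.eventually_cofinite.1 h3) fun α hα => ?_
        exact not_lt.2 (le_of_lt hα)
      refine (h2.image U).subset ?_
      rintro _ ⟨⟨α, rfl⟩, hα⟩
      exact ⟨α, hα, rfl⟩
  have h1 : Countable Omega1 := by
    have h2 : (U '' Set.univ).Countable := by rwa [Set.image_univ]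
    exact Set.countable_univ_iff.1 (Set.countable_of_injective_of_countable_image hU.injOn h2)
  exact not_countable h1

/-! ### The weak point-countable chain condition -/

theorem exists_embedding_omega1 {A : Type 1} {s : Set A} (hs : ¬ s.Countable) :
    ∃ u : Omega1 → A, Function.Injective u ∧ ∀ α, u α ∈ s := by
  have h1 : Cardinal.mk Omega1 ≤ Cardinal.mk s := by
    rw [Omega1.mk_eq, ← Cardinal.succ_aleph0, Order.succ_le_iff]
    exact not_le.1 fun h => hs (Cardinal.le_aleph0_iff_set_countable.1 h)
  obtain ⟨u⟩ := h1
  exact ⟨fun α => (u α).1, Subtype.val_injective.comp u.injective, fun α => (u α).2⟩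

namespace DJPConstruction

variable {S : Omega1 → Set (List (Omega1 × ℕ))} {D : DJPConstruction S}

/-- Uncountably many finite sets of points of bounded size, where the set with index `α` contains
the first point at `α`, include an uncountable family that consists of a common part and of sets
that are consecutive and above the common part. -/
theorem exists_consecutive_root {A : Set Omega1} (hA : ¬ A.Countable)
    {H : Omega1 → Finset D.Points} {N : ℕ} (hN : ∀ α ∈ A, (H α).card = N)
    (hfirst : ∀ α, Points.first D α ∈ H α) :
    ∃ (R : Finset D.Points) (ρ : Omega1) (B : Set Omega1), (∀ q ∈ R, q.height < ρ) ∧ B ⊆ A ∧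
      ¬ B.Countable ∧
      (∀ α ∈ B, R ⊆ H α ∧ Points.first D α ∉ R ∧ ∀ q ∈ H α, q ∉ R → ρ < q.height) ∧
      ∀ α ∈ B, ∀ β ∈ B, α < β → ∀ p ∈ H α, p ∉ R → ∀ q ∈ H β, q ∉ R → p.height < q.height := by
  classical
  obtain ⟨R, hR, hRmax⟩ := exists_maximal_root hA H N fun α hα => (hN α hα).le
  -- There are only countably many points up to height `β`, and by the choice of `R` each one
  -- outside `R` belongs to only countably many of the sets.
  have hcount : ∀ β, {α ∈ A | R ⊆ H α ∧ ∃ q ∈ H α, q ∉ R ∧ q.height ≤ β}.Countable := by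
    intro β
    refine (((countable_height_le (D := D) β).mono
      (Set.inter_subset_left (t := {q | q ∉ R}))).biUnion fun q hq => hRmax q hq.2).mono ?_
    rintro α ⟨hα, hRα, q, hq, hqR, hle⟩
    exact Set.mem_biUnion (show q ∈ _ ∩ _ from ⟨hle, hqR⟩) ⟨hα, hRα, hq⟩
  obtain ⟨ρ, hρ⟩ := Omega1.exists_gt_of_countable
    (R.finite_toSet.image Points.height).countable
  have hρ' : ∀ q ∈ R, q.height < ρ := fun q hq => hρ _ ⟨q, hq, rfl⟩
  have habove : ∀ β, ∃ α ∈ A, R ⊆ H α ∧ β < α ∧ ∀ q ∈ H α, q ∉ R → β < q.height := by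
    intro β
    obtain ⟨α, ⟨hα, hRα⟩, hα'⟩ :
        ({α ∈ A | R ⊆ H α} \ (Set.Iic β ∪
          {α ∈ A | R ⊆ H α ∧ ∃ q ∈ H α, q ∉ R ∧ q.height ≤ β})).Nonempty := by
      rw [Set.sdiff_nonempty]
      exact fun h => hR (((Omega1.countable_Iic β).union (hcount β)).mono h)
    exact ⟨α, hα, hRα, not_le.1 fun h => hα' (Or.inl h), fun q hq hqR =>
      not_le.1 fun h => hα' (Or.inr ⟨hα, hRα, q, hq, hqR, h⟩)⟩
  let A' : Set Omega1 := {α ∈ A | R ⊆ H α ∧ ρ < α ∧ ∀ q ∈ H α, q ∉ R → ρ < q.height}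
  have hnotR : ∀ α, ρ < α → Points.first D α ∉ R := fun α hα h => hα.not_gt (hρ' _ h)
  obtain ⟨Y, hY, hchain⟩ := exists_uncountable_isChain (A := A') (fun α β => α.1 < β.1 ∧
      ∀ p ∈ H α, p ∉ R → ∀ q ∈ H β, q ∉ R → p.height < q.height) (by
    intro C hC
    obtain ⟨β, hβ⟩ := Omega1.exists_gt_of_countable
      (hC.biUnion fun c _ => ((H c.1).finite_toSet.image Points.height).countable)
    have hβ' : ∀ c ∈ C, ∀ p ∈ H c.1, p.height < β := fun c hc p hp =>
      hβ _ (Set.mem_biUnion hc ⟨p, hp, rfl⟩)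
    obtain ⟨α, hα, hRα, hlt, habv⟩ := habove (max ρ β)
    have hr : ∀ c ∈ C, c.1 < α := fun c hc =>
      (hβ' c hc _ (hfirst c.1)).trans ((le_max_right _ _).trans_lt hlt)
    refine ⟨⟨α, hα, hRα, (le_max_left _ _).trans_lt hlt, fun q hq hqR =>
      (le_max_left _ _).trans_lt (habv q hq hqR)⟩, fun h => (hr _ h).false, fun c hc =>
      ⟨hr c hc, fun p hp _ q hq hqR => ?_⟩⟩
    exact (hβ' c hc p hp).trans ((le_max_right _ _).trans_lt (habv q hq hqR)))
  refine ⟨R, ρ, Subtype.val '' Y, hρ', ?_, fun h =>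
    hY (Set.countable_of_injective_of_countable_image Subtype.val_injective.injOn h), ?_, ?_⟩
  · rintro _ ⟨y, -, rfl⟩
    exact y.2.1
  · rintro _ ⟨y, -, rfl⟩
    exact ⟨y.2.2.1, hnotR _ y.2.2.2.1, y.2.2.2.2⟩
  · rintro _ ⟨x, hx, rfl⟩ _ ⟨y, hy, rfl⟩ hxy
    rcases hchain hx hy (fun h => hxy.ne (congrArg _ h)) with h | h
    · exact h.2
    · exact absurd h.1 hxy.not_gt

/-- If the tuples guessed at `γ` are the tuples `l α`, then a locally constant function that takes
the value `i` at the `i`-th point of `γ` takes the values `0, …, m - 1` on all but finitely many of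
the tuples. -/
theorem finite_bad_tuples (hS : IsGuessing S) {γ : Omega1} (hγ : Order.IsSuccLimit γ) {m : ℕ}
    (hm : IsTupleGuess S D.mult γ m) {J : Type*} {e : D.Points → J} (he : IsLocallyConstant e)
    {v : Fin m → J} (hv : ∀ (i : Fin m) (q : D.Points), q.1 = (γ, i.1) → e q = v i) :
    {s ∈ S γ | ¬ ∀ i : Fin m, ∃ q : D.Points, s[i.1]? = some q.1 ∧ e q = v i}.Finite := by
  have hmult := D.mult_of_guess γ hγ m hm
  have h1 : ∀ i : Fin m,
      {s ∈ S γ | ¬ ∃ q : D.Points, s[i.1]? = some q.1 ∧ e q = v i}.Finite := by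
    intro i
    let q₀ : D.Points := ⟨(γ, i.1), hmult ▸ i.2⟩
    obtain ⟨β, hβ, hsub⟩ := (he.isOpen_fiber (v i) : IsOpen {q : D.Points | e q = v i}) q₀
      (hv i q₀ rfl) hγ
    refine ((D.piece_guess γ hγ m hm i.1 i.2).union (hS.converges γ hγ β hβ)).subset ?_
    rintro s ⟨hs, hbad⟩
    by_contra hcon
    simp only [Set.mem_union, Set.mem_ofPred_eq, not_or, not_and, not_not] at hcon
    obtain ⟨q, hq, hsq⟩ := hcon.1 hs
    refine hbad ⟨q, hsq, hsub q hq (not_le.1 fun hle => ?_)⟩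
    exact hcon.2 hs ⟨q.1, List.mem_of_getElem? hsq, hle⟩
  refine (Set.finite_iUnion h1).subset ?_
  rintro s ⟨hs, hbad⟩
  obtain ⟨i, hi⟩ := not_forall.1 hbad
  exact Set.mem_iUnion.2 ⟨i, hs, hi⟩

/-- The point of the space that an abstract index stands for: a point of `R`, the point at infinity
or a term of a tuple. -/
def indexedPoint (R : Finset D.Points) {m : ℕ} (l : List D.Points) :
    Option (R ⊕ Fin m) → D.Space
  | none => OnePoint.infty
  | some (Sum.inl q) => (q.1 : D.Space)
  | some (Sum.inr i) => l[i.1]?.elim OnePoint.infty (↑)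

/-- One continuous function is built that belongs to infinitely many of the given sets, by copying
the values of one `f α₀` to almost all the tuples guessed at some `γ`. -/
theorem weaklyPcc (hS : IsGuessing S) (D : DJPConstruction S) (n : ℕ) :
    WeaklyPcc C(Fin n → D.Space, ℝ) := by
  classical
  intro 𝒰 hopen hfin
  by_contra hunc
  obtain ⟨u, hu, hu𝒰⟩ := exists_embedding_omega1 (s := 𝒰 \ {∅}) fun h =>
    hunc ((h.union (Set.countable_singleton ∅)).mono (by simp))
  have hne : ∀ α, ∃ f : C(Fin n → D.Space, ℝ), toWeakSpace ℝ _ f ∈ u α := by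
    intro α
    obtain ⟨x, hx⟩ := Set.nonempty_iff_ne_empty.2 (hu𝒰 α).2
    exact ⟨(toWeakSpace ℝ _).symm x, by simpa using hx⟩
  choose f hf using hne
  have hbasic : ∀ α, _ := fun α => exists_finite_of_isOpen_weakSpace
    (isClopen_pi_toOmega1Closed_le (D := D) n) (finite_fiber_pi_toOmega1Closed n)
    (hopen _ (hu𝒰 α).1) (hf α) ⌈‖f α‖⌉₊
  choose F hF δ hδ hFδ using hbasic
  choose k hk using fun α => exists_nat_one_div_lt (hδ α)
  -- Including the first point at `α` makes the tuples nonempty and different for different `α`.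
  have hHfin : ∀ α, {q : D.Points | q = Points.first D α ∨ ∃ x ∈ F α, ∃ j, x j = q}.Finite := by
    intro α
    refine (Set.finite_singleton _).union ?_
    refine Set.Finite.of_finite_image (f := ((↑) : D.Points → D.Space)) ?_
      OnePoint.coe_injective.injOn
    refine ((hF α).biUnion fun x _ => Set.finite_range x).subset ?_
    rintro _ ⟨q, ⟨x, hx, j, hj⟩, rfl⟩
    exact Set.mem_biUnion hx ⟨j, hj⟩
  let H : Omega1 → Finset D.Points := fun α => (hHfin α).toFinset
  have hH : ∀ α q, q ∈ H α ↔ q = Points.first D α ∨ ∃ x ∈ F α, ∃ j, x j = q := fun α q =>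
    (hHfin α).mem_toFinset
  obtain ⟨⟨M, K, N⟩, hA⟩ := Set.exists_uncountable_fiber (Set.not_countable_univ (α := Omega1))
    fun α => (⌈‖f α‖⌉₊, k α, (H α).card)
  obtain ⟨R, ρ, B, hRρ, hBA, hB, hBR, hBlt⟩ := exists_consecutive_root (D := D) hA (N := N)
    (fun α hα => congrArg (fun t => t.2.2) hα.2) fun α => (hH α _).2 (Or.inl rfl)
  have hBM : ∀ α ∈ B, ⌈‖f α‖⌉₊ = M := fun α hα => congrArg (fun t => t.1) (hBA hα).2
  have hBK : ∀ α ∈ B, k α = K := fun α hα => congrArg (fun t => t.2.1) (hBA hα).2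
  have hBN : ∀ α ∈ B, (H α).card = N := fun α hα => congrArg (fun t => t.2.2) (hBA hα).2
  let m := N - R.card
  let l : Omega1 → List D.Points := fun α => (H α \ R).toList
  have hl : ∀ α q, q ∈ l α ↔ q ∈ H α ∧ q ∉ R := by simp [l]
  have hlen : ∀ α ∈ B, (l α).length = m := by
    intro α hα
    rw [Finset.length_toList, Finset.card_sdiff_of_subset (hBR α hα).1, hBN α hα]
  have hlfirst : ∀ α ∈ B, Points.first D α ∈ l α := fun α hα =>
    (hl α _).2 ⟨(hH α _).2 (Or.inl rfl), (hBR α hα).2.1⟩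
  let τ : Omega1 → Option (R ⊕ Fin m) → D.Space := fun α => indexedPoint R (l α)
  -- The values at all combinations of indexed points are rounded to multiples of `1 / (K + 1)`.
  -- There are finitely many combinations, hence countably many patterns.
  obtain ⟨c, hC⟩ := Set.exists_uncountable_fiber hB
    fun α (y : Fin n → Option (R ⊕ Fin m)) => ⌊f α (τ α ∘ y) * (K + 1)⌋
  let t : Omega1 → List (Omega1 × ℕ) := fun α => (l α).map fun q => q.1
  have ht : ∀ α p, p ∈ t α ↔ ∃ q : D.Points, q ∈ l α ∧ q.1 = p := fun α p => List.mem_map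
  have htlt : ∀ α ∈ B, ∀ β ∈ B, α < β → ∀ p ∈ t α, ∀ q ∈ t β, p.1 < q.1 := by
    intro α hα β hβ hαβ p hp q hq
    obtain ⟨p, hpα, rfl⟩ := (ht _ _).1 hp
    obtain ⟨q, hqβ, rfl⟩ := (ht _ _).1 hq
    rw [hl] at hpα hqβ
    exact hBlt α hα β hβ hαβ p hpα.1 hpα.2 q hqβ.1 hqβ.2
  have htinj : Set.InjOn t B := by
    have h1 : ∀ α ∈ B, ∀ β ∈ B, α < β → t α ≠ t β := by
      intro α hα β hβ hαβ heq
      have h2 := (ht _ _).2 ⟨_, hlfirst α hα, rfl⟩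
      exact (htlt α hα β hβ hαβ _ h2 _ (heq ▸ h2)).false
    intro α hα β hβ heq
    rcases lt_trichotomy α β with h | h | h
    · exact absurd heq (h1 α hα β hβ h)
    · exact h
    · exact absurd heq.symm (h1 β hβ α hα h)
  set C := {α ∈ B | (fun y => ⌊f α (τ α ∘ y) * (K + 1)⌋) = c}
  have hCB : C ⊆ B := fun α hα => hα.1
  obtain ⟨γ, hγ, hguess⟩ := hS.guesses (t '' C)
    (fun h => hC (Set.countable_of_injective_of_countable_image (htinj.mono hCB) h)) (by
      rintro _ ⟨α, hα, rfl⟩ _ ⟨β, hβ, rfl⟩ hne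
      rcases lt_trichotomy α β with h | h | h
      · exact Or.inl (htlt α hα.1 β hβ.1 h)
      · exact absurd (h ▸ rfl) hne
      · exact Or.inr fun p hp q hq => htlt β hβ.1 α hα.1 h q hq p hp)
  obtain ⟨_, hs₀⟩ := (hS.infinite γ hγ).nonempty
  obtain ⟨α₀, hα₀, rfl⟩ := hguess hs₀
  have hm : IsTupleGuess S D.mult γ m := by
    refine ⟨hlen α₀ hα₀.1 ▸ List.length_pos_of_mem (hlfirst α₀ hα₀.1), fun s hs => ?_⟩
    obtain ⟨α, hα, rfl⟩ := hguess hs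
    refine ⟨(List.length_map _).trans (hlen α hα.1),
      (Finset.nodup_toList _).map Subtype.val_injective, fun p hp => ?_⟩
    obtain ⟨q, -, rfl⟩ := (ht _ _).1 hp
    exact q.2
  have hmult := D.mult_of_guess γ hγ m hm
  -- This keeps the new points at `γ` apart from the root, which lies below `ρ`.
  have hργ : ρ < γ := by
    have h1 := (ht _ _).2 ⟨_, hlfirst α₀ hα₀.1, rfl⟩
    exact ((hBR α₀ hα₀.1).2.2 _ ((hl _ _).1 (hlfirst α₀ hα₀.1)).1 (hBR α₀ hα₀.1).2.1).trans
      (hS.lt γ hγ _ hs₀ _ h1)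
  let top : Fin m → D.Points := fun i => ⟨(γ, i.1), lt_of_lt_of_eq i.2 hmult.symm⟩
  let σ : Option (R ⊕ Fin m) → D.Space := fun j =>
    j.elim OnePoint.infty (Sum.elim (fun q => (q.1 : D.Space)) fun i => (top i : D.Space))
  have hσ : Function.Injective σ := by
    have hne : ∀ (q : R) (i : Fin m), q.1 ≠ top i := by
      intro q i h
      have h1 := hRρ _ q.2
      rw [h] at h1
      exact hργ.not_gt h1
    rintro (_ | q | i) (_ | r | j) h
    · rfl
    · exact absurd h.symm (OnePoint.coe_ne_infty _)
    · exact absurd h.symm (OnePoint.coe_ne_infty _)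
    · exact absurd h (OnePoint.coe_ne_infty _)
    · rw [Subtype.ext (OnePoint.coe_injective h)]
    · exact absurd (OnePoint.coe_injective h) (hne q j)
    · exact absurd h (OnePoint.coe_ne_infty _)
    · exact absurd (OnePoint.coe_injective h).symm (hne r i)
    · have h1 : i.1 = j.1 := congrArg (fun q : D.Points => q.1.2) (OnePoint.coe_injective h)
      rw [Fin.ext h1]
  obtain ⟨e, he, heσ⟩ := exists_isLocallyConstant_leftInverse hσ
  have hbad := finite_bad_tuples hS hγ hm (e := fun q : D.Points => e q)
    (he.comp_continuous OnePoint.continuous_coe) (v := fun i => some (Sum.inr i))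
    fun i q hq => by
      rw [show q = top i from Subtype.ext hq]
      exact heσ (some (Sum.inr i))
  have hgood := (hS.infinite γ hγ).sdiff hbad
  -- In each coordinate, `e` finds the index of the cell and `τ α₀` returns the point with this
  -- index for `α₀`; `g` is continuous because this folding is locally constant, and its norm is at
  -- most that of `f α₀`.
  let g : C(Fin n → D.Space, ℝ) := (f α₀).comp
    ⟨fun x j => τ α₀ (e (x j)), continuous_pi fun j =>
      (he.comp (τ α₀)).continuous.comp (continuous_apply j)⟩
  have hg : ∀ α ∈ C, t α ∈ S γ \ {s ∈ S γ | ¬ ∀ i : Fin m, ∃ q : D.Points,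
      s[i.1]? = some q.1 ∧ e q = some (Sum.inr i)} → toWeakSpace ℝ _ g ∈ u α := by
    intro α hα htα
    have hlg : ∀ i : Fin m, ∃ q : D.Points, (l α)[i.1]? = some q ∧ e q = some (Sum.inr i) := by
      intro i
      obtain ⟨q, hq, hqi⟩ := not_not.1 (fun h => htα.2 ⟨htα.1, h⟩) i
      obtain ⟨r, hr, hrq⟩ := Option.map_eq_some_iff.1 (List.getElem?_map.symm.trans hq)
      exact ⟨r, hr, Subtype.ext hrq ▸ hqi⟩
    -- For a good tuple every indexed point lies in the cell of its own index, so `g` takes there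
    -- the value of `f α₀` at the corresponding point.
    have heτ : ∀ j, e (τ α j) = j := by
      rintro (_ | q | i)
      · exact heσ none
      · exact heσ (some (Sum.inl q))
      · obtain ⟨q, hq, hqi⟩ := hlg i
        simp only [τ, indexedPoint, hq, Option.elim_some]
        exact hqi
    refine hFδ α g ?_ fun x hx => ?_
    · rw [hBM α hα.1, ← hBM α₀ hα₀.1]
      refine ((ContinuousMap.norm_le _ (norm_nonneg (f α₀))).2 fun x => ?_).trans (Nat.le_ceil _)
      exact (f α₀).norm_coe_le_norm _
    · have hy : ∀ j, ∃ y, τ α y = x j := by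
        intro j
        rcases hxj : x j with _ | q
        · exact ⟨none, rfl⟩
        · have hqH := (hH α q).2 (Or.inr ⟨x, hx, j, hxj⟩)
          by_cases hqR : q ∈ R
          · exact ⟨some (Sum.inl ⟨q, hqR⟩), rfl⟩
          · obtain ⟨i, hi, hiq⟩ := List.getElem_of_mem ((hl α q).2 ⟨hqH, hqR⟩)
            refine ⟨some (Sum.inr ⟨i, hlen α hα.1 ▸ hi⟩), ?_⟩
            simp only [τ, indexedPoint, List.getElem?_eq_getElem hi, hiq, Option.elim_some]
            rfl
      choose y hy using hy
      obtain rfl : τ α ∘ y = x := funext hy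
      have h1 : g (τ α ∘ y) = f α₀ (τ α₀ ∘ y) := by
        show f α₀ (fun j => τ α₀ (e (τ α (y j)))) = _
        simp only [heτ]
        rfl
      have h2 : ⌊f α₀ (τ α₀ ∘ y) * (K + 1)⌋ = ⌊f α (τ α ∘ y) * (K + 1)⌋ :=
        (congrFun hα₀.2 y).trans (congrFun hα.2 y).symm
      have h3 := Int.abs_sub_lt_one_of_floor_eq_floor h2
      have hK : (0 : ℝ) < K + 1 := by positivity
      rw [← sub_mul, abs_mul, abs_of_pos hK, ← lt_div_iff₀ hK] at h3
      rw [h1]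
      exact h3.trans (hBK α hα.1 ▸ hk α)
  have hinf : {α ∈ C | toWeakSpace ℝ _ g ∈ u α}.Infinite := by
    refine Set.Infinite.of_image t (hgood.mono ?_)
    intro s hs
    obtain ⟨α, hα, rfl⟩ := hguess hs.1
    exact ⟨α, ⟨hα, hg α hα hs⟩, rfl⟩
  refine hinf (Set.Finite.of_finite_image ((hfin (toWeakSpace ℝ _ g)).subset ?_) hu.injOn)
  rintro _ ⟨α, hα, rfl⟩
  exact ⟨(hu𝒰 α).1, hα.2⟩

end DJPConstruction

theorem mainTheorem12 (hclub : ClubPrinciple) :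
    (∃ S : Omega1 → Set (List (Omega1 × ℕ)), IsGuessing S) ∧
    ∀ S : Omega1 → Set (List (Omega1 × ℕ)), IsGuessing S →
      Nonempty (DJPConstruction S) ∧
      ∀ D : DJPConstruction S,
        T2Space D.Space ∧
        (∃ φ : D.Space → Omega1Closed, Continuous φ ∧ Function.Surjective φ ∧
          ∀ a, (φ ⁻¹' {a}).Finite) ∧
        (∀ n : ℕ, WeaklyPcc C(Fin n → D.Space, ℝ)) ∧
        (∀ n : ℕ, ¬ ContainsComplementedC0Omega1 C(Fin n → D.Space, ℝ)) ∧
        ¬ LindelofSpace (WeakSpace ℝ C(D.Space, ℝ)) :=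
  ⟨hclub.exists_isGuessing, fun _ hS => ⟨hS.nonempty_djpConstruction, fun D =>
    ⟨inferInstance, ⟨_, D.continuous_toOmega1Closed, D.surjective_toOmega1Closed,
      D.finite_fiber_toOmega1Closed⟩, fun n => D.weaklyPcc hS n,
      fun n => (D.weaklyPcc hS n).not_containsComplementedC0Omega1, D.not_lindelofSpace⟩⟩⟩
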